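/- Let $d\ge 3$ and let $P_x$ be the law of simple random walk $(X_n)_{n\ge 0}$ on $\mathbb Z^d$ started at $x$, with Green function $g(x,y)=\sum_{n\ge 0}P_x[X_n=y]$. For finite $I\subset\mathbb Z^d$ let $e_I(x)=P_x[X_n\notin I\text{ for all }n\ge 1]\,1_I(x)$ be its equilibrium measure, $\operatorname{cap}(I)=\sum_x e_I(x)$ its capacity, $G_I=(g(x,y))_{x,y\in I}$, $g_I=\det G_I$ (with $g_\emptyset=1$), and $c_I$ the sum of all entries of the matrix of cofactors of $G_I$ (with $c_\emptyset=0$). Let $\widehat W$ be the space of doubly infinite sequences $(X_n,\sigma_n)_{n\in\mathbb Z}$ in $\mathbb Z^d\times(0,\infty)$ such that $(X_n)$ is a nearest neighbour trajectory spending finite time in every finite set and $\sum_{n\ge0}\sigma_n=\sum_{n\le 0}\sigma_n=\infty$. Let $\widehat W^*$ be the quotient of $\widehat W$ by time shift, with projection $\pi^*$ and the quotient $\sigma$-algebra. For finite $K$ let $\widehat Q_K$ be the measure on $\widehat W$ with $\widehat Q_K(X_0=x)=e_K(x)$ under which, conditionally on $X_0=x$ (when $e_K(x)>0$), $(X_n)_{n\ge0}$,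 $(X_{-n})_{n\ge0}$ and $(\sigma_n)_{n\in\mathbb Z}$ are independent and distributed respectively as simple random walk from $x$, as simple random walk from $x$ conditioned never to return to $K$, and as i.i.d. exponential variables of parameter $1$. Let $\widehat\nu$ be the $\sigma$-finite measure on $\widehat W^*$ whose restriction to the trajectories entering $K$ is the image of $\widehat Q_K$ under $\pi^*$, for every finite $K$. Let $\omega=\sum_{i\ge0}\delta_{(\widehat w_i^*,u_i)}$ be the continuous time interlacement point process, that is, a Poisson point process on $\widehat W^*\times\mathbb R_+$ with intensity $\widehat\nu(d\widehat w^*)\,du$ such that only finitely many trajectories with label at most $u$ enter $K$, for all finite $K$ and $u\ge0$. Its occupation times are $$L_{x,u}(\omega)=\sum_{i\ge0}\sum_{n\in\mathbb Z}\sigma_n(\widehat w_i)\,1\{X_n(\widehat w_i)=x,\ u_i\le u\},\qquad x\in\mathbb Z^d,\ u\ge0,$$ where $\pi^*(\widehat w_i)=\widehat w_i^*$. **Theorem 2.3.** For every finite $I\subset\mathbb Z^d$ one has $g_I>0$ and $c_I/g_I=\operatorname{cap}(I)$. Moreover, for every finite $K\subset\mathbb Z^d$ there is a constant $c(K)>0$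 (depending only on $d$ and $K$) such that the following holds for every $V:\mathbb Z^d\to\mathbb R$ vanishing outside $K$ which satisfies $\|V\|_\infty\le c(K)$ or is nonnegative. Put $V_I=\prod_{x\in I}V(x)$ (with $V_\emptyset=1$). Then $\sum_{I\subset K}g_IV_I>0$, and for every $u\ge0$ the variable $\exp\{-\sum_xV(x)L_{x,u}\}$ is integrable and $$\mathbb E\Big[\exp\Big\{-\sum_{x}V(x)L_{x,u}\Big\}\Big]=\exp\Big\{-u\,\frac{\sum_{I\subset K}c_IV_I}{\sum_{I\subset K}g_IV_I}\Big\}.$$ -/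

import Mathlib

open MeasureTheory ProbabilityTheory
open scoped NNReal ENNReal

noncomputable section

namespace Interlacement

/-! ### Simple random walk on the lattice, Green function, capacity -/

/-- The lattice `ℤ^d`. -/
abbrev Lattice (d : ℕ) : Type := Fin d → ℤ

/-- The `2d` unit vectors `± e_i` of the lattice. -/
def unitVector {d : ℕ} (s : Fin d × Bool) : Lattice d :=
  Pi.single s.1 (if s.2 then 1 else -1)

/-- The uniform law on the `2d` unit vectors. -/
def stepLaw (d : ℕ) [NeZero d] : Measure (Lattice d) :=
  ((PMF.uniformOfFintype (Fin d × Bool)).map unitVector).toMeasure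

instance (d : ℕ) [NeZero d] : IsProbabilityMeasure (stepLaw d) := by
  unfold stepLaw; infer_instance

/-- The trajectory `X_n = x + ξ_0 + ⋯ + ξ_{n-1}` with starting point `x` and steps `ξ`. -/
def walk {d : ℕ} (x : Lattice d) (ξ : ℕ → Lattice d) (n : ℕ) : Lattice d :=
  x + ∑ k ∈ Finset.range n, ξ k

/-- The law of the trajectory `(X_n)_{n ≥ 0}` of simple random walk on `ℤ^d` started at `x`. -/
def walkLaw {d : ℕ} [NeZero d] (x : Lattice d) : Measure (ℕ → Lattice d) :=
  (Measure.infinitePi fun _ : ℕ => stepLaw d).map (walk x)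

/-- The Green function `g(x, y) = ∑_{n ≥ 0} P_x[X_n = y]`. -/
def green {d : ℕ} [NeZero d] (x y : Lattice d) : ℝ :=
  ∑' n : ℕ, (walkLaw x).real {X | X n = y}

/-- The event that the trajectory does not visit `K` at any time `n ≥ 1`. -/
def neverReturns {d : ℕ} (K : Finset (Lattice d)) : Set (ℕ → Lattice d) :=
  {X | ∀ n, 1 ≤ n → X n ∉ K}

/-- The equilibrium measure `e_K(x) = P_x[X_n ∉ K for all n ≥ 1] 1_K(x)`. -/
def equilibrium {d : ℕ} [NeZero d] (K : Finset (Lattice d)) (x : Lattice d) : ℝ≥0∞ :=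
  if x ∈ K then walkLaw x (neverReturns K) else 0

/-- The capacity of `K`: the total mass of its equilibrium measure. -/
def capacity {d : ℕ} [NeZero d] (K : Finset (Lattice d)) : ℝ :=
  ∑ x ∈ K, (equilibrium K x).toReal

/-- The matrix `G_I = (g(x, y))_{x, y ∈ I}`. -/
def greenMatrix {d : ℕ} [NeZero d] (I : Finset (Lattice d)) : Matrix I I ℝ :=
  Matrix.of fun x y => green x.1 y.1

/-- `g_I = det G_I`; the determinant of the empty matrix is `1`. -/
def greenDet {d : ℕ} [NeZero d] (I : Finset (Lattice d)) : ℝ :=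
  (greenMatrix I).det

/-- `c_I`, the sum of all entries of the matrix of cofactors of `G_I`, which is the transpose of
the adjugate of `G_I`; the sum is `0` for the empty matrix. -/
def cofactorSum {d : ℕ} [NeZero d] (I : Finset (Lattice d)) : ℝ :=
  ∑ x, ∑ y, (greenMatrix I).adjugate.transpose x y

/-! ### Doubly infinite trajectories with holding times, modulo time shift -/

/-- Doubly infinite sequences with values in `ℤ^d × ℝ`, the second component being the
holding time. -/
abbrev MarkedPath (d : ℕ) : Type := ℤ → Lattice d × ℝ

/-- The set `Ŵ` of doubly infinite nearest neighbour trajectories on `ℤ^d` which spend finite time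
in finite sets, with positive holding times whose forward and backward sums are infinite. -/
def trajectories (d : ℕ) : Set (MarkedPath d) :=
  {w | (∀ n, ∑ i, |(w (n + 1)).1 i - (w n).1 i| = 1) ∧
    (∀ K : Finset (Lattice d), {n | (w n).1 ∈ K}.Finite) ∧
    (∀ n, 0 < (w n).2) ∧
    ∑' n : ℕ, ENNReal.ofReal (w n).2 = ∞ ∧
    ∑' n : ℕ, ENNReal.ofReal (w (-n)).2 = ∞}

/-- The space `Ŵ`, with the σ-algebra generated by the coordinates. -/
abbrev Trajectory (d : ℕ) : Type := trajectories d

/-- Two trajectories are equivalent when they differ by a time shift. -/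
def shiftSetoid (d : ℕ) : Setoid (Trajectory d) where
  r w w' := ∃ k : ℤ, ∀ n : ℤ, w.1 n = w'.1 (n + k)
  iseqv :=
    { refl := fun _ => ⟨0, fun n => by simp⟩
      symm := fun ⟨k, hk⟩ => ⟨-k, fun n => by simpa using (hk (n + -k)).symm⟩
      trans := fun ⟨k, hk⟩ ⟨l, hl⟩ => ⟨k + l, fun n => by rw [hk, hl, add_assoc]⟩ }

/-- The space `Ŵ*` of trajectories modulo time shift, with the quotient σ-algebra. -/
abbrev TrajectoryClass (d : ℕ) : Type := Quotient (shiftSetoid d)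

/-- The canonical projection `π* : Ŵ → Ŵ*`. -/
def proj {d : ℕ} (w : Trajectory d) : TrajectoryClass d :=
  Quotient.mk (shiftSetoid d) w

/-- The set of classes of trajectories which enter `K`. -/
def entering {d : ℕ} (K : Finset (Lattice d)) : Set (TrajectoryClass d) :=
  proj '' {w | ∃ n, (w.1 n).1 ∈ K}

/-! ### The intensity measure of continuous time random interlacements -/

instance : IsProbabilityMeasure (expMeasure 1) :=
  isProbabilityMeasure_expMeasure one_pos

/-- The doubly infinite marked path with forward part `X`, backward part `Y` and holding
times `σ`. -/
def glue {d : ℕ} (p : (ℕ → Lattice d) × (ℕ → Lattice d) × (ℤ → ℝ)) : MarkedPath d :=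
  fun n => (if 0 ≤ n then p.1 n.toNat else p.2.1 (-n).toNat, p.2.2 n)

/-- The measure `Q̂_K`, on all marked paths: it gives mass `e_K(x)` to `X_0 = x`, and
conditionally on `X_0 = x` the forward part is simple random walk from `x`, the backward part is
simple random walk from `x` conditioned never to return to `K`, the holding times are i.i.d.
exponential with parameter `1`, and these three are independent. -/
def pathMeasure {d : ℕ} [NeZero d] (K : Finset (Lattice d)) : Measure (MarkedPath d) :=
  ∑ x ∈ K, equilibrium K x •
    ((walkLaw x).prod ((cond (walkLaw x) (neverReturns K)).prod
      (Measure.infinitePi fun _ : ℤ => expMeasure 1))).map glue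

/-- The measure `Q̂_K` on `Ŵ`. -/
def trajectoryMeasure {d : ℕ} [NeZero d] (K : Finset (Lattice d)) : Measure (Trajectory d) :=
  (pathMeasure K).comap Subtype.val

/-- `ν` is the σ-finite measure `ν̂` on `Ŵ*` whose restriction to the classes entering `K` is the
image of `Q̂_K` under `π*`, for every finite set `K`. -/
structure IsInterlacementMeasure {d : ℕ} [NeZero d] (ν : Measure (TrajectoryClass d)) : Prop where
  sigmaFinite : SigmaFinite ν
  restrict_entering : ∀ K : Finset (Lattice d),
    ν.restrict (entering K) = (trajectoryMeasure K).map proj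

/-! ### Poisson point processes and continuous time random interlacements -/

/-- `N` is a Poisson random measure with intensity `μ` under `P`: the mass of a measurable set of
finite intensity is Poisson distributed with that intensity as parameter, the mass of a set of
infinite intensity is a.s. infinite, and the masses of disjoint sets are independent. -/
structure IsPoissonRandomMeasure {Ω E : Type*} [MeasurableSpace Ω] [MeasurableSpace E]
    (P : Measure Ω) (N : Ω → Measure E) (μ : Measure E) : Prop where
  measurable : Measurable N
  law : ∀ A, MeasurableSet A → μ A ≠ ∞ →
    P.map (fun ω => N ω A) = (poissonMeasure (μ A).toNNReal).map (Nat.cast : ℕ → ℝ≥0∞)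
  law_top : ∀ A, MeasurableSet A → μ A = ∞ → ∀ᵐ ω ∂P, N ω A = ∞
  indep : ∀ (m : ℕ) (A : Fin m → Set E), (∀ i, MeasurableSet (A i)) →
    Pairwise (fun i j => Disjoint (A i) (A j)) → iIndepFun (fun i ω => N ω (A i)) P

/-- The point measures `∑_{i ≥ 0} δ_{(w*_i, u_i)}` on `Ŵ* × ℝ_+` for which finitely many
trajectories with label at most `u` enter `K`, for all finite `K` and all `u ≥ 0`. -/
def configurations (d : ℕ) : Set (Measure (TrajectoryClass d × ℝ≥0)) :=
  {η | (∃ p : ℕ → TrajectoryClass d × ℝ≥0, η = Measure.sum fun i => Measure.dirac (p i)) ∧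
    ∀ (K : Finset (Lattice d)) (u : ℝ≥0), η (entering K ×ˢ Set.Iic u) < ∞}

/-- Lebesgue measure on `ℝ_+`. -/
def halfLineVolume : Measure ℝ≥0 :=
  (volume : Measure ℝ).comap ((↑) : ℝ≥0 → ℝ)

/-- `N` is the continuous time interlacement point process on `ℤ^d` under `P`: a Poisson point
process on `Ŵ* × ℝ_+` with intensity `ν̂(dw*) du`. -/
structure IsInterlacementProcess {d : ℕ} [NeZero d] {Ω : Type*} [MeasurableSpace Ω]
    (P : Measure Ω) (N : Ω → Measure (TrajectoryClass d × ℝ≥0)) : Prop where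
  mem_configurations : ∀ ω, N ω ∈ configurations d
  poisson : ∃ ν : Measure (TrajectoryClass d), IsInterlacementMeasure ν ∧
    IsPoissonRandomMeasure P N (ν.prod halfLineVolume)

/-! ### Occupation times -/

/-- The total time `∑_{n ∈ ℤ} σ_n 1{X_n = x}` spent at `x` by a trajectory modulo time shift. -/
def timeSpent {d : ℕ} (x : Lattice d) : TrajectoryClass d → ℝ≥0∞ :=
  Quotient.lift
    (fun w : Trajectory d => ∑' n : ℤ, if (w.1 n).1 = x then ENNReal.ofReal (w.1 n).2 else 0)
    (by
      rintro w w' ⟨k, hk⟩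
      simp only [hk]
      exact (Equiv.addRight k).tsum_eq
        (fun n : ℤ => if (w'.1 n).1 = x then ENNReal.ofReal (w'.1 n).2 else 0))

/-- The occupation time `L_{x,u}` of a configuration: the sum over its points `(w*_i, u_i)` with
`u_i ≤ u` of the time spent at `x` by `w*_i`. -/
def occupationTime {d : ℕ} (x : Lattice d) (u : ℝ≥0)
    (η : Measure (TrajectoryClass d × ℝ≥0)) : ℝ :=
  (∫⁻ p, (if p.2 ≤ u then timeSpent x p.1 else 0) ∂η).toReal

lemma measurable_timeSpent {d : ℕ} (x : Lattice d) : Measurable (timeSpent x) := by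
  apply measurable_from_quotient.2
  change Measurable (fun w : Trajectory d =>
    ∑' n : ℤ, if (w.1 n).1 = x then ENNReal.ofReal (w.1 n).2 else 0)
  refine Measurable.tsum fun n => ?_
  have h : Measurable fun w : Trajectory d => w.1 n :=
    (measurable_pi_apply n).comp measurable_subtype_coe
  exact Measurable.ite (h.fst (measurableSet_singleton x)) h.snd.ennreal_ofReal measurable_const

/-- The occupation time written as a double sum, in terms of representatives of the classes. -/
lemma occupationTime_sum_dirac {d : ℕ} (x : Lattice d) (u : ℝ≥0) (w : ℕ → Trajectory d)
    (t : ℕ → ℝ≥0) :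
    occupationTime x u (Measure.sum fun i => Measure.dirac (proj (w i), t i)) =
      (∑' i : ℕ, ∑' n : ℤ,
        if ((w i).1 n).1 = x ∧ t i ≤ u then ENNReal.ofReal ((w i).1 n).2 else 0).toReal := by
  unfold occupationTime
  rw [lintegral_sum_measure]
  congr 2
  funext i
  rw [lintegral_dirac']
  · by_cases h : t i ≤ u
    · simp [h, timeSpent, proj]
    · simp [h]
  · exact Measurable.ite (measurable_snd measurableSet_Iic)
      ((measurable_timeSpent x).comp measurable_fst) measurable_const

/-- `Ŵ` is a measurable set, so that restricting measures to it is unproblematic. -/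
lemma measurableSet_trajectories (d : ℕ) : MeasurableSet (trajectories d) := by
  have h : ∀ n : ℤ, Measurable fun w : MarkedPath d => w n := fun n => measurable_pi_apply n
  have hfin : ∀ K : Finset (Lattice d),
      MeasurableSet {w : MarkedPath d | {n | (w n).1 ∈ K}.Finite} := by
    intro K
    have : {w : MarkedPath d | {n | (w n).1 ∈ K}.Finite} =
        ⋃ F : Finset ℤ, ⋂ n : ℤ, ⋂ _ : n ∉ F, {w | (w n).1 ∉ K} := by
      ext w
      simp only [Set.mem_ofPred_eq, Set.mem_iUnion, Set.mem_iInter]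
      constructor
      · intro hw
        exact ⟨hw.toFinset, fun n hn hK => hn (by simpa using hK)⟩
      · rintro ⟨F, hF⟩
        exact F.finite_toSet.subset fun n hn => by
          by_contra hc
          exact hF n hc hn
    rw [this]
    refine MeasurableSet.iUnion fun F => MeasurableSet.iInter fun n => MeasurableSet.iInter fun _ =>
      ?_
    exact (h n).fst (MeasurableSet.of_discrete (s := {y : Lattice d | y ∉ K}))
  have e : trajectories d =
      (⋂ n : ℤ, {w : MarkedPath d | ∑ i, |(w (n + 1)).1 i - (w n).1 i| = 1}) ∩
      ((⋂ K : Finset (Lattice d), {w : MarkedPath d | {n | (w n).1 ∈ K}.Finite}) ∩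
      ((⋂ n : ℤ, {w : MarkedPath d | 0 < (w n).2}) ∩
      ({w : MarkedPath d | ∑' n : ℕ, ENNReal.ofReal (w n).2 = ∞} ∩
      {w : MarkedPath d | ∑' n : ℕ, ENNReal.ofReal (w (-n)).2 = ∞}))) := by
    ext w
    simp [trajectories]
  rw [e]
  refine (MeasurableSet.iInter fun n => ?_).inter ((MeasurableSet.iInter hfin).inter
    ((MeasurableSet.iInter fun n => ?_).inter (MeasurableSet.inter ?_ ?_)))
  · have hm : Measurable fun w : MarkedPath d => ((w (n + 1)).1, (w n).1) :=
      (h (n + 1)).fst.prodMk (h n).fst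
    exact hm (MeasurableSet.of_discrete
      (s := {q : Lattice d × Lattice d | ∑ i, |q.1 i - q.2 i| = 1}))
  · exact measurableSet_lt measurable_const (h n).snd
  · exact (Measurable.tsum fun n : ℕ => (h n).snd.ennreal_ofReal)
      (measurableSet_singleton ∞)
  · exact (Measurable.tsum fun n : ℕ => (h (-n)).snd.ennreal_ofReal)
      (measurableSet_singleton ∞)

end Interlacement

end

noncomputable section

namespace Interlacement

section

/-! ### Determinants -/

/-! Write `φ x` for `feynmanKac V x`, the expectation of `exp (-∑ V(X_n) σ_n)` for the walk from
`x`. The trajectories entering `K` with label at most `u` have finite intensity, so the Laplace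
functional of a Poisson measure (`IsPoissonRandomMeasure.integral_exp_neg`) gives the expectation as
the exponential of an integral against `ν`, computed with `pathMeasure K`. There the backward part
avoids `K`, so a trajectory collects `V` only along its forward walk, and the exponent is `u ∑
e_K(x) (φ x - 1)`.

The function `φ` solves `φ + G V φ = 1` (`IsAdmissible.feynmanKac_add`). Since `G` is symmetric and
`G e_K = 1` on `K`, the exponent becomes `-u ∑ V φ`. Linear algebra identifies this sum with the
stated ratio (`sum_powerset_ratio`): `∑ g_I V_I = det (1 + G V)`, and adding one to every entry of
`G` changes `g_I` into `g_I + c_I` while perturbing `1 + G V` by a matrix of rank one.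

The analytic engine is a uniqueness principle. If `|u|` is subharmonic and dominated by a multiple
of the expected number of visits to `K`, then `u = 0` (`eq_zero_of_abs_le_stepAvg`), because visits
after time `n` become negligible. Hence a dominated function whose Laplacian lives on `K` is the
potential of that Laplacian (`eq_sum_green_mul`). This yields `G e_K = 1` and the equation for `φ`;
the vanishing statement also keeps the determinants of the killed Green function away from zero,
which gives `g_I > 0`. Transience itself comes from an explicit superharmonic function, and
integrability for signed `V` from a smallness condition on the negative part (`IsAdmissible`). -/

lemma det_one_add_mul_diagonal {n : Type*} [Fintype n] [DecidableEq n] (A : Matrix n n ℝ)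
    (v : n → ℝ) :
    (1 + A * Matrix.diagonal v).det =
      ∑ s : Finset n, (A.submatrix Subtype.val Subtype.val : Matrix s s ℝ).det * ∏ i ∈ s, v i := by
  rw [Matrix.det_one_add_mul_comm, add_comm]
  change Matrix.detRowAlternating
    ((fun i => (Matrix.diagonal v * A) i) + fun i => (1 : Matrix n n ℝ) i) = _
  -- Multilinearity in the rows: each row is taken either from `diagonal v * A`, with a factor `v
  -- i`, or from the identity. Identity rows outside `s` reduce the determinant to the principal
  -- minor on `s`.
  rw [AlternatingMap.map_add_univ]
  refine Finset.sum_congr rfl fun s _ => ?_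
  have h : s.piecewise (fun i => (Matrix.diagonal v * A) i) (fun i => (1 : Matrix n n ℝ) i) =
      fun i => (if i ∈ s then v i else 1) • s.piecewise A.row (1 : Matrix n n ℝ).row i := by
    funext i j
    by_cases hi : i ∈ s <;> simp [hi, Matrix.diagonal_mul, Matrix.row, Finset.piecewise]
  rw [h, AlternatingMap.map_smul_univ, ← Matrix.det_piecewise_one_eq_submatrix_det, smul_eq_mul,
    mul_comm, Finset.prod_ite_mem, Finset.univ_inter]
  rfl

/-- The kernel is left arbitrary because the identity is used for `g` and for `g + 1`. -/
lemma sum_powerset_det_mul_prod {α : Type*} [DecidableEq α] (g : α → α → ℝ) (K : Finset α)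
    (V : α → ℝ) :
    ∑ I ∈ K.powerset, (Matrix.of fun x y : I => g x y).det * ∏ x ∈ I, V x =
      (1 + (Matrix.of fun x y : K => g x y) * Matrix.diagonal fun x : K => V x).det := by
  rw [det_one_add_mul_diagonal]
  symm
  refine Finset.sum_bij (fun s _ => s.map (Function.Embedding.subtype _)) ?_ ?_ ?_ ?_
  · intro s _
    simp only [Finset.mem_powerset]
    intro x hx
    simp only [Finset.mem_map, Function.Embedding.coe_subtype] at hx
    obtain ⟨y, _, rfl⟩ := hx
    exact y.2
  · intro s _ t _ h
    exact Finset.map_injective _ h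
  · intro I hI
    refine ⟨I.subtype (· ∈ K), Finset.mem_univ _, ?_⟩
    rw [Finset.subtype_map]
    exact Finset.filter_true_of_mem fun x hx => Finset.mem_powerset.1 hI hx
  · intro s _
    rw [Finset.prod_map]
    congr 1
    let e : s ≃ (s.map (Function.Embedding.subtype (· ∈ K)) : Finset α) :=
      Equiv.ofBijective (fun x => ⟨x.1.1, Finset.mem_map_of_mem _ x.2⟩)
        ⟨fun x y h => by
          simp only at h
          exact Subtype.ext (Subtype.ext (Subtype.mk.inj h)), fun y => by
          obtain ⟨z, hz, hy⟩ := Finset.mem_map.1 y.2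
          exact ⟨⟨z, hz⟩, Subtype.ext hy⟩⟩
    rw [← Matrix.det_submatrix_equiv_self e]
    rfl

/-- The all-ones matrix has rank one, so the matrix determinant lemma applies. This makes the sum of
cofactors a difference of two determinants, to which the expansion in principal minors applies. -/
lemma det_add_ones {n : Type*} [Fintype n] [DecidableEq n] (A : Matrix n n ℝ) (hA : A.det ≠ 0) :
    (Matrix.of fun x y => A x y + 1).det = A.det + ∑ x, ∑ y, A.adjugate x y := by
  have h : (Matrix.of fun x y => A x y + 1) =
      A + Matrix.replicateCol Unit (1 : n → ℝ) * Matrix.replicateRow Unit (1 : n → ℝ) := by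
    ext x y
    simp [Matrix.mul_apply]
  rw [h, Matrix.det_add_replicateCol_mul_replicateRow (isUnit_iff_ne_zero.2 hA),
    Matrix.det_unique (n := Unit),
    Matrix.inv_def, Ring.inverse_eq_inv']
  simp only [Matrix.add_apply, Matrix.one_apply_eq, Matrix.mul_apply, Matrix.smul_apply,
    Matrix.replicateCol_apply, Matrix.replicateRow_apply, Pi.one_apply, one_mul, mul_one,
    smul_eq_mul, mul_add, ← Finset.mul_sum]
  rw [mul_inv_cancel_left₀ hA, Finset.sum_comm]

/-- The matrix determinant lemma for a rank one perturbation `1 vᵀ`, in terms of a solution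
of `M φ = 1`. -/
lemma det_add_col_ones {n : Type*} [Fintype n] [DecidableEq n] (M : Matrix n n ℝ)
    (hM : M.det ≠ 0) (v φ : n → ℝ) (hφ : M.mulVec φ = 1) :
    (Matrix.of fun x y => M x y + v y).det = M.det * (1 + ∑ y, v y * φ y) := by
  have h : (Matrix.of fun x y => M x y + v y) =
      M + Matrix.replicateCol Unit (1 : n → ℝ) * Matrix.replicateRow Unit v := by
    ext x y
    simp [Matrix.mul_apply]
  have hi : M⁻¹.mulVec 1 = φ := by
    rw [← hφ, Matrix.mulVec_mulVec, Matrix.nonsing_inv_mul _ (isUnit_iff_ne_zero.2 hM),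
      Matrix.one_mulVec]
  rw [h, Matrix.det_add_replicateCol_mul_replicateRow (isUnit_iff_ne_zero.2 hM),
    Matrix.det_unique (n := Unit),
    Matrix.mul_assoc]
  congr 1
  rw [Matrix.add_apply, Matrix.one_apply_eq, Matrix.mul_apply]
  congr 1
  refine Finset.sum_congr rfl fun y _ => ?_
  rw [Matrix.replicateRow_apply, ← hi]
  rfl

/-- The ratio of the sums over principal minors, in terms of a solution of `(1 + G V) φ = 1`. -/
lemma sum_powerset_ratio {α : Type*} [DecidableEq α] (g : α → α → ℝ) (K : Finset α) (V φ : α → ℝ)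
    (hg : ∀ I ⊆ K, (Matrix.of fun x y : I => g x y).det ≠ 0)
    (hV : ∑ I ∈ K.powerset, (Matrix.of fun x y : I => g x y).det * ∏ x ∈ I, V x ≠ 0)
    (hφ : ∀ x ∈ K, φ x + ∑ y ∈ K, g x y * (V y * φ y) = 1) :
    (∑ I ∈ K.powerset,
        (∑ x, ∑ y, (Matrix.of fun x y : I => g x y).adjugate.transpose x y) * ∏ x ∈ I, V x) /
      ∑ I ∈ K.powerset, (Matrix.of fun x y : I => g x y).det * ∏ x ∈ I, V x =
    ∑ y ∈ K, V y * φ y := by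
  set D := ∑ I ∈ K.powerset, (Matrix.of fun x y : I => g x y).det * ∏ x ∈ I, V x with hD
  -- The sum of minors of the shifted kernel `g + 1` is evaluated twice: here minor by minor, and in
  -- `h2` as one determinant, a rank one perturbation of `1 + G V`. Comparison gives the ratio.
  have h1 : ∑ I ∈ K.powerset, (Matrix.of fun x y : I => g x y + 1).det * ∏ x ∈ I, V x =
      D + ∑ I ∈ K.powerset,
        (∑ x, ∑ y, (Matrix.of fun x y : I => g x y).adjugate.transpose x y) * ∏ x ∈ I, V x := by
    rw [hD, ← Finset.sum_add_distrib]
    refine Finset.sum_congr rfl fun I hI => ?_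
    rw [← add_mul]
    congr 1
    have := det_add_ones (Matrix.of fun x y : I => g x y) (hg I (Finset.mem_powerset.1 hI))
    simp only [Matrix.of_apply] at this
    rw [this]
    congr 1
    exact Finset.sum_comm
  have h2 : ∑ I ∈ K.powerset, (Matrix.of fun x y : I => g x y + 1).det * ∏ x ∈ I, V x =
      D * (1 + ∑ y ∈ K, V y * φ y) := by
    rw [sum_powerset_det_mul_prod (fun x y => g x y + 1)]
    rw [sum_powerset_det_mul_prod] at hD
    rw [hD] at hV ⊢
    have h3 := det_add_col_ones
      (1 + (Matrix.of fun x y : K => g x y) * Matrix.diagonal fun x : K => V x) hV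
      (fun y => V y) (fun y => φ y) (by
        ext x
        rw [Matrix.add_mulVec, Matrix.one_mulVec, ← Matrix.mulVec_mulVec, Pi.add_apply,
          Pi.one_apply, ← hφ x x.2, ← Finset.sum_coe_sort K]
        congr 1
        simp [Matrix.mulVec, dotProduct, Matrix.diagonal_apply])
    rw [← Finset.sum_coe_sort K, ← h3]
    congr 1
    ext x y
    simp [Matrix.mul_diagonal, add_mul, add_assoc]
  have h4 := h1.symm.trans h2
  rw [div_eq_iff hV]
  linarith

/-! ### Laplace functional of a Poisson random measure -/

lemma lintegral_exp_poissonMeasure (r : ℝ≥0) (a : ℝ) :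
    ∫⁻ n, ENNReal.ofReal (Real.exp (a * n)) ∂(poissonMeasure r) =
      ENNReal.ofReal (Real.exp (r * (Real.exp a - 1))) := by
  have h1 : HasSum (fun n : ℕ => Real.exp (-r) * (r * Real.exp a) ^ n / n.factorial)
      (Real.exp (r * (Real.exp a - 1))) := by
    have := (NormedSpace.expSeries_div_hasSum_exp (r * Real.exp a)).mul_left (Real.exp (-r))
    rw [← Real.exp_eq_exp_ℝ, ← Real.exp_add] at this
    convert! this using 2 <;> ring_nf
  rw [← h1.tsum_eq, ENNReal.ofReal_tsum_of_nonneg (fun n => by positivity) h1.summable,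
    lintegral_countable']
  refine tsum_congr fun n => ?_
  rw [poissonMeasure_singleton, ← ENNReal.ofReal_mul (by positivity)]
  congr 1
  rw [mul_pow, ← Real.exp_nat_mul, mul_comm a]
  ring

variable {Ω E : Type*} [MeasurableSpace Ω] [MeasurableSpace E] {P : Measure Ω}
  {N : Ω → Measure E} {μ : Measure E}

lemma IsPoissonRandomMeasure.measurable_apply (h : IsPoissonRandomMeasure P N μ) {A : Set E}
    (hA : MeasurableSet A) : Measurable fun ω => N ω A :=
  (Measure.measurable_coe hA).comp h.measurable

lemma IsPoissonRandomMeasure.lintegral_exp (h : IsPoissonRandomMeasure P N μ) {A : Set E}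
    (hA : MeasurableSet A) (hμ : μ A ≠ ∞) (a : ℝ) :
    ∫⁻ ω, ENNReal.ofReal (Real.exp (a * (N ω).real A)) ∂P =
      ENNReal.ofReal (Real.exp (μ.real A * (Real.exp a - 1))) := by
  have hm : Measurable fun t : ℝ≥0∞ => ENNReal.ofReal (Real.exp (a * t.toReal)) := by fun_prop
  have := lintegral_map (μ := P) hm (h.measurable_apply hA)
  rw [h.law A hA hμ, lintegral_map hm .of_discrete] at this
  simp only [Measure.real]
  rw [← this]
  rw [← ENNReal.coe_toNNReal_eq_toReal]
  simpa using lintegral_exp_poissonMeasure (μ A).toNNReal a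

lemma IsPoissonRandomMeasure.ae_lt_top [IsProbabilityMeasure P]
    (h : IsPoissonRandomMeasure P N μ) {A : Set E}
    (hA : MeasurableSet A) (hμ : μ A ≠ ∞) : ∀ᵐ ω ∂P, N ω A < ∞ := by
  have : ∀ᵐ t ∂(P.map fun ω => N ω A), t < ∞ := by
    rw [h.law A hA hμ, ae_map_iff Measurable.of_discrete.aemeasurable measurableSet_Iio]
    exact ae_of_all _ fun n => ENNReal.natCast_lt_top n
  exact ae_of_ae_map (h.measurable_apply hA).aemeasurable this

lemma IsPoissonRandomMeasure.lintegral_exp_sum (h : IsPoissonRandomMeasure P N μ)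
    {ι : Type*} (R : Finset ι) (A : ι → Set E) (hA : ∀ i ∈ R, MeasurableSet (A i))
    (hd : ∀ i ∈ R, ∀ j ∈ R, i ≠ j → Disjoint (A i) (A j))
    (hμ : ∀ i ∈ R, μ (A i) ≠ ∞) (a : ι → ℝ) :
    ∫⁻ ω, ENNReal.ofReal (Real.exp (∑ i ∈ R, a i * (N ω).real (A i))) ∂P =
      ENNReal.ofReal (Real.exp (∑ i ∈ R, μ.real (A i) * (Real.exp (a i) - 1))) := by
  -- Independence is available for families indexed by `Fin m`, hence the reindexing.
  let e := R.equivFin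
  have hi := h.indep R.card (fun k => A (e.symm k)) (fun k => hA _ (e.symm k).2)
    (fun k l hkl => hd _ (e.symm k).2 _ (e.symm l).2
      (fun hh => hkl (e.symm.injective (Subtype.ext hh))))
  have hm : ∀ k : Fin R.card, Measurable
      fun t : ℝ≥0∞ => ENNReal.ofReal (Real.exp (a (e.symm k) * t.toReal)) := fun k => by fun_prop
  have hi' := hi.comp _ hm
  have := lintegral_prod_eq_prod_lintegral_of_indepFun Finset.univ _ hi'
    (fun k => (hm k).comp (h.measurable_apply (hA _ (e.symm k).2)))
  have hsum : ∀ F : ι → ℝ, ∑ i ∈ R, F i = ∑ k, F (e.symm k) := fun F => by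
    rw [← Finset.sum_coe_sort]
    exact (e.symm.sum_comp fun i : R => F i).symm
  simp_rw [hsum, Real.exp_sum, ENNReal.ofReal_prod_of_nonneg fun i _ => (Real.exp_pos _).le]
  refine this.trans (Finset.prod_congr rfl fun k _ => ?_)
  exact h.lintegral_exp (hA _ (e.symm k).2) (hμ _ (e.symm k).2) _

/-- Once the value `0` is erased, the remaining fibres lie in `A` and have finite mass even if `m`
is infinite. The formula is used both for the random measure, with `F` the identity, and for the
intensity, with `F y = exp y - 1`. -/
lemma integral_comp_simpleFunc {m : Measure E} (φ : SimpleFunc E ℝ) {A : Set E} (hm : m A < ∞)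
    (hφ : ∀ z, z ∉ A → φ z = 0) (F : ℝ → ℝ) (hF : F 0 = 0) :
    ∫ z, F (φ z) ∂m = ∑ y ∈ φ.range.erase 0, m.real (φ ⁻¹' {y}) * F y := by
  have h1 : ∀ z, F (φ z) = ∑ y ∈ φ.range.erase 0, (φ ⁻¹' {y}).indicator (fun _ => F y) z := by
    intro z
    by_cases hz : φ z = 0
    · rw [hz, hF, Finset.sum_eq_zero]
      intro y hy
      rw [Set.indicator_of_notMem]
      intro h
      exact (Finset.mem_erase.1 hy).1 (by rw [← hz]; exact h.symm)
    · rw [Finset.sum_eq_single_of_mem (φ z) (Finset.mem_erase.2 ⟨hz, φ.mem_range_self z⟩)]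
      · simp
      · intro y _ hy
        rw [Set.indicator_of_notMem]
        exact fun h => hy h.symm
  simp_rw [h1]
  rw [integral_finsetSum]
  · refine Finset.sum_congr rfl fun y _ => ?_
    rw [integral_indicator_const _ (φ.measurableSet_fiber y), smul_eq_mul]
  · intro y hy
    refine (integrable_indicator_iff (φ.measurableSet_fiber y)).2 (integrableOn_const ?_)
    refine ((measure_mono fun z hz => ?_).trans_lt hm).ne
    by_contra hc
    exact (Finset.mem_erase.1 hy).1 (by rw [← hφ z hc]; exact hz.symm)

lemma IsPoissonRandomMeasure.lintegral_exp_simpleFunc [IsProbabilityMeasure P]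
    (h : IsPoissonRandomMeasure P N μ) (φ : SimpleFunc E ℝ) {A : Set E} (hA : MeasurableSet A)
    (hμ : μ A < ∞) (hφ : ∀ z, z ∉ A → φ z = 0) :
    ∫⁻ ω, ENNReal.ofReal (Real.exp (∫ z, φ z ∂N ω)) ∂P =
      ENNReal.ofReal (Real.exp (∫ z, (Real.exp (φ z) - 1) ∂μ)) := by
  rw [integral_comp_simpleFunc φ hμ hφ (fun y => Real.exp y - 1) (by simp),
    ← h.lintegral_exp_sum (φ.range.erase 0) (fun y => φ ⁻¹' {y})
      (fun y _ => φ.measurableSet_fiber y) ?_ ?_ fun y => y]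
  · refine lintegral_congr_ae ?_
    filter_upwards [h.ae_lt_top hA hμ.ne] with ω hω
    rw [integral_comp_simpleFunc φ hω hφ (fun y => y) rfl]
    simp only [mul_comm]
  · intro y _ y' _ hy
    exact Disjoint.preimage _ (by simpa using hy)
  · intro y hy
    refine ((measure_mono fun z hz => ?_).trans_lt hμ).ne
    by_contra hc
    exact (Finset.mem_erase.1 hy).1 (by rw [← hφ z hc]; exact hz.symm)

lemma exists_simpleFunc_tendsto_of_nonneg {f : E → ℝ} (hf : Measurable f) (h0 : ∀ z, 0 ≤ f z) :
    ∃ F : ℕ → SimpleFunc E ℝ, (∀ z, Filter.Tendsto (fun n => F n z) Filter.atTop (nhds (f z))) ∧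
      ∀ n z, 0 ≤ F n z ∧ F n z ≤ f z := by
  have hm : Measurable fun z => ENNReal.ofReal (f z) := hf.ennreal_ofReal
  refine ⟨fun n => (SimpleFunc.eapprox (fun z => ENNReal.ofReal (f z)) n).map ENNReal.toReal,
    fun z => ?_, fun n z => ⟨ENNReal.toReal_nonneg, ?_⟩⟩
  · have := (ENNReal.tendsto_toReal ENNReal.ofReal_ne_top).comp (SimpleFunc.tendsto_eapprox hm z)
    rw [ENNReal.toReal_ofReal (h0 z)] at this
    exact this
  · rw [SimpleFunc.map_apply]
    refine (ENNReal.toReal_mono ENNReal.ofReal_ne_top ?_).trans_eq (ENNReal.toReal_ofReal (h0 z))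
    rw [← SimpleFunc.iSup_eapprox_apply hm z]
    exact le_iSup (fun k => SimpleFunc.eapprox (fun z => ENNReal.ofReal (f z)) k z) n

/-- The positive and negative parts are approximated separately. The first bound dominates the
integrals along the sequence and keeps the support; the second controls `exp (-F n)` by the negative
part of `f` alone. -/
lemma exists_simpleFunc_tendsto {f : E → ℝ} (hf : Measurable f) :
    ∃ F : ℕ → SimpleFunc E ℝ, (∀ z, Filter.Tendsto (fun n => F n z) Filter.atTop (nhds (f z))) ∧
      ∀ n z, |F n z| ≤ |f z| ∧ max (-F n z) 0 ≤ max (-f z) 0 := by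
  obtain ⟨F, hF, hF'⟩ := exists_simpleFunc_tendsto_of_nonneg (hf.max measurable_const)
    (fun z => le_max_right (f z) 0)
  obtain ⟨G, hG, hG'⟩ := exists_simpleFunc_tendsto_of_nonneg (hf.neg.max measurable_const)
    (fun z => le_max_right (-f z) 0)
  refine ⟨fun n => F n - G n, fun z => ?_, fun n z => ?_⟩
  · have := (hF z).sub (hG z)
    rw [show max (f z) 0 - max ((-f) z) 0 = f z from by
      rw [Pi.neg_apply]
      rcases le_total (f z) 0 with h | h
      · rw [max_eq_right h, max_eq_left (by linarith)]; ring
      · rw [max_eq_left h, max_eq_right (by linarith)]; ring] at this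
    exact this
  · have h1 := hF' n z
    have h2 := hG' n z
    rw [Pi.neg_apply] at h2
    change |F n z - G n z| ≤ |f z| ∧ max (-(F n z - G n z)) 0 ≤ max (-f z) 0
    obtain ⟨⟨_, _⟩, _, _⟩ := And.intro h1 h2
    rcases le_total (f z) 0 with h | h
    · have e1 : max (f z) 0 = 0 := max_eq_right h
      have e2 : max (-f z) 0 = -f z := max_eq_left (by linarith)
      rw [abs_of_nonpos h, e2]
      exact ⟨abs_le.2 ⟨by linarith, by linarith⟩, max_le (by linarith) (by linarith)⟩
    · have e1 : max (f z) 0 = f z := max_eq_left h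
      have e2 : max (-f z) 0 = 0 := max_eq_right (by linarith)
      rw [abs_of_nonneg h, e2]
      exact ⟨abs_le.2 ⟨by linarith, by linarith⟩, max_le (by linarith) le_rfl⟩

/-- The integrals of the positive and negative parts in `[0, ∞]` depend measurably on the measure.
Their difference is the Bochner integral only where `f` is integrable, so measurability holds only
up to a null set. -/
lemma aemeasurable_integral_randomMeasure (hN : Measurable N) {f : E → ℝ} (hf : Measurable f)
    (hi : ∀ᵐ ω ∂P, Integrable f (N ω)) : AEMeasurable (fun ω => ∫ z, f z ∂N ω) P := by
  refine ⟨fun ω => (∫⁻ z, ENNReal.ofReal (f z) ∂N ω).toReal -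
    (∫⁻ z, ENNReal.ofReal (-f z) ∂N ω).toReal, ?_, ?_⟩
  · exact ((Measure.measurable_lintegral hf.ennreal_ofReal).comp hN).ennreal_toReal.sub
      ((Measure.measurable_lintegral hf.neg.ennreal_ofReal).comp hN).ennreal_toReal
  · filter_upwards [hi] with ω hω
    exact integral_eq_lintegral_pos_part_sub_lintegral_neg_part hω

/-- Fatou's lemma along simple functions increasing at most to `f`. An inequality is enough: it
serves to provide the finite exponential moment that dominates in the signed case. -/
lemma IsPoissonRandomMeasure.lintegral_exp_le [IsProbabilityMeasure P]
    (h : IsPoissonRandomMeasure P N μ) {f : E → ℝ} (hf : Measurable f) (h0 : ∀ z, 0 ≤ f z)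
    {A : Set E} (hA : MeasurableSet A) (hμ : μ A < ∞) (hfA : ∀ z, z ∉ A → f z = 0)
    (hi : ∀ᵐ ω ∂P, Integrable f (N ω)) (hexp : Integrable (fun z => Real.exp (f z) - 1) μ) :
    ∫⁻ ω, ENNReal.ofReal (Real.exp (∫ z, f z ∂N ω)) ∂P ≤
      ENNReal.ofReal (Real.exp (∫ z, (Real.exp (f z) - 1) ∂μ)) := by
  obtain ⟨F, hF, hF'⟩ := exists_simpleFunc_tendsto_of_nonneg hf h0
  have hFA : ∀ n z, z ∉ A → F n z = 0 := fun n z hz =>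
    le_antisymm ((hF' n z).2.trans_eq (hfA z hz)) (hF' n z).1
  have hFi : ∀ᵐ ω ∂P, ∀ n, Integrable (F n) (N ω) := by
    filter_upwards [hi] with ω hω n
    refine hω.mono (F n).measurable.aestronglyMeasurable (ae_of_all _ fun z => ?_)
    rw [Real.norm_of_nonneg (hF' n z).1, Real.norm_of_nonneg (h0 z)]
    exact (hF' n z).2
  have hlim : ∀ᵐ ω ∂P, Filter.Tendsto
      (fun n => ENNReal.ofReal (Real.exp (∫ z, F n z ∂N ω))) Filter.atTop
      (nhds (ENNReal.ofReal (Real.exp (∫ z, f z ∂N ω)))) := by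
    filter_upwards [hi] with ω hω
    refine (ENNReal.continuous_ofReal.comp Real.continuous_exp).continuousAt.tendsto.comp ?_
    refine tendsto_integral_of_dominated_convergence f
      (fun n => (F n).measurable.aestronglyMeasurable) hω
      (fun n => ae_of_all _ fun z => ?_) (ae_of_all _ hF)
    rw [Real.norm_of_nonneg (hF' n z).1]
    exact (hF' n z).2
  calc ∫⁻ ω, ENNReal.ofReal (Real.exp (∫ z, f z ∂N ω)) ∂P
      = ∫⁻ ω, Filter.liminf (fun n => ENNReal.ofReal (Real.exp (∫ z, F n z ∂N ω)))
          Filter.atTop ∂P := by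
        refine lintegral_congr_ae ?_
        filter_upwards [hlim] with ω hω
        exact hω.liminf_eq.symm
    _ ≤ Filter.liminf (fun n => ∫⁻ ω, ENNReal.ofReal (Real.exp (∫ z, F n z ∂N ω)) ∂P)
          Filter.atTop := by
        refine lintegral_liminf_le' fun n => ?_
        exact (Real.measurable_exp.comp_aemeasurable (aemeasurable_integral_randomMeasure
          h.measurable (F n).measurable (hFi.mono fun ω hω => hω n))).ennreal_ofReal
    _ ≤ Filter.liminf (fun _ : ℕ => ENNReal.ofReal (Real.exp (∫ z, (Real.exp (f z) - 1) ∂μ)))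
          Filter.atTop := by
        refine Filter.liminf_le_liminf (Filter.Eventually.of_forall fun n => ?_)
        rw [h.lintegral_exp_simpleFunc (F n) hA hμ (hFA n)]
        refine ENNReal.ofReal_le_ofReal (Real.exp_le_exp.2 ?_)
        refine integral_mono_of_nonneg (ae_of_all _ fun z => ?_) hexp (ae_of_all _ fun z => ?_)
        · have := Real.one_le_exp (hF' n z).1
          simpa using this
        · have := Real.exp_le_exp.2 (hF' n z).2
          simpa using this
    _ = _ := Filter.liminf_const _

/-- The Laplace functional of a Poisson random measure, for a signed function supported in a set
of finite intensity, whose negative part has exponential moments. -/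
theorem IsPoissonRandomMeasure.integral_exp_neg [IsProbabilityMeasure P]
    (h : IsPoissonRandomMeasure P N μ) {f : E → ℝ} (hf : Measurable f)
    {A : Set E} (hA : MeasurableSet A) (hμ : μ A < ∞) (hfA : ∀ z, z ∉ A → f z = 0)
    (hi : ∀ᵐ ω ∂P, Integrable f (N ω))
    (hexp : Integrable (fun z => Real.exp (max (-f z) 0) - 1) μ) :
    Integrable (fun ω => Real.exp (-∫ z, f z ∂N ω)) P ∧
      ∫ ω, Real.exp (-∫ z, f z ∂N ω) ∂P = Real.exp (∫ z, (Real.exp (-f z) - 1) ∂μ) := by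
  obtain ⟨F, hF, hF'⟩ := exists_simpleFunc_tendsto hf
  have hFA : ∀ n z, z ∉ A → F n z = 0 := fun n z hz => by
    simpa [hfA z hz] using (hF' n z).1
  have hFi : ∀ᵐ ω ∂P, ∀ n, Integrable (F n) (N ω) := by
    filter_upwards [hi] with ω hω n
    exact hω.mono (F n).measurable.aestronglyMeasurable (ae_of_all _ fun z => (hF' n z).1)
  have hqm : Measurable fun z => max (-f z) 0 := hf.neg.max measurable_const
  have hqi : ∀ᵐ ω ∂P, Integrable (fun z => max (-f z) 0) (N ω) := by
    filter_upwards [hi] with ω hω using hω.neg_part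
  -- The exponential of the integrated negative part dominates every approximation at once.
  have hD : Integrable (fun ω => Real.exp (∫ z, max (-f z) 0 ∂N ω)) P := by
    refine ⟨(Real.measurable_exp.comp_aemeasurable (aemeasurable_integral_randomMeasure
      h.measurable hqm hqi)).aestronglyMeasurable, ?_⟩
    rw [hasFiniteIntegral_iff_ofReal (ae_of_all _ fun ω => (Real.exp_pos _).le)]
    refine (h.lintegral_exp_le hqm (fun z => le_max_right _ _) hA hμ (fun z hz => ?_) hqi
      hexp).trans_lt ENNReal.ofReal_lt_top
    simp [hfA z hz]
  have hmeas : ∀ g : E → ℝ, Measurable g → (∀ᵐ ω ∂P, Integrable g (N ω)) →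
      AEStronglyMeasurable (fun ω => Real.exp (-∫ z, g z ∂N ω)) P := fun g hg hgi =>
    (Real.measurable_exp.comp_aemeasurable
      (aemeasurable_integral_randomMeasure h.measurable hg hgi).neg).aestronglyMeasurable
  have hle : ∀ g : E → ℝ, (∀ z, max (-g z) 0 ≤ max (-f z) 0) → (∀ᵐ ω ∂P, Integrable g (N ω)) →
      ∀ᵐ ω ∂P, ‖Real.exp (-∫ z, g z ∂N ω)‖ ≤ Real.exp (∫ z, max (-f z) 0 ∂N ω) := by
    intro g hg hgi
    filter_upwards [hgi, hqi] with ω h1 h2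
    rw [Real.norm_of_nonneg (Real.exp_pos _).le, ← integral_neg]
    exact Real.exp_le_exp.2 (integral_mono h1.neg h2 fun z => (le_max_left _ _).trans (hg z))
  refine ⟨hD.mono' (hmeas f hf hi) (hle f (fun z => le_rfl) hi), ?_⟩
  have hlim1 : Filter.Tendsto (fun n => ∫ ω, Real.exp (-∫ z, F n z ∂N ω) ∂P) Filter.atTop
      (nhds (∫ ω, Real.exp (-∫ z, f z ∂N ω) ∂P)) := by
    refine tendsto_integral_of_dominated_convergence _
      (fun n => hmeas _ (F n).measurable (hFi.mono fun ω hω => hω n)) hD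
      (fun n => hle _ (fun z => (hF' n z).2) (hFi.mono fun ω hω => hω n)) ?_
    filter_upwards [hi] with ω hω
    refine (Real.continuous_exp.comp continuous_neg).continuousAt.tendsto.comp ?_
    exact tendsto_integral_of_dominated_convergence (fun z => |f z|)
      (fun n => (F n).measurable.aestronglyMeasurable) hω.abs
      (fun n => ae_of_all _ fun z => (hF' n z).1) (ae_of_all _ hF)
  have heq : ∀ n, ∫ ω, Real.exp (-∫ z, F n z ∂N ω) ∂P =
      Real.exp (∫ z, (Real.exp (-F n z) - 1) ∂μ) := by
    intro n
    have := h.lintegral_exp_simpleFunc (-F n) hA hμ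
      (fun z hz => by rw [SimpleFunc.coe_neg, Pi.neg_apply, hFA n z hz, neg_zero])
    simp only [SimpleFunc.coe_neg, Pi.neg_apply, integral_neg] at this
    rw [integral_eq_lintegral_of_nonneg_ae (ae_of_all _ fun ω => (Real.exp_pos _).le)
      (hmeas _ (F n).measurable (hFi.mono fun ω hω => hω n)), this,
      ENNReal.toReal_ofReal (Real.exp_pos _).le]
  have hlim2 : Filter.Tendsto (fun n => ∫ ω, Real.exp (-∫ z, F n z ∂N ω) ∂P) Filter.atTop
      (nhds (Real.exp (∫ z, (Real.exp (-f z) - 1) ∂μ))) := by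
    simp_rw [heq]
    refine Real.continuous_exp.continuousAt.tendsto.comp ?_
    -- On `A` the difference `exp (-F n) - 1` lies between `-1` and `exp (max (-f) 0) - 1`. The
    -- indicator of `A` pays for the lower bound and is integrable since `μ A` is finite.
    refine tendsto_integral_of_dominated_convergence
      (fun z => (Real.exp (max (-f z) 0) - 1) + A.indicator (fun _ => 1) z)
      (fun n => ((F n).measurable.neg.exp.sub_const 1).aestronglyMeasurable)
      (hexp.add ((integrable_indicator_iff hA).2 (integrableOn_const hμ.ne)))
      (fun n => ae_of_all _ fun z => ?_) (ae_of_all _ fun z => ?_)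
    · have hq : 1 ≤ Real.exp (max (-f z) 0) := Real.one_le_exp (le_max_right _ _)
      by_cases hz : z ∈ A
      · rw [Set.indicator_of_mem hz, Real.norm_eq_abs, abs_le]
        have h1 : Real.exp (-F n z) ≤ Real.exp (max (-f z) 0) :=
          Real.exp_le_exp.2 ((le_max_left _ _).trans (hF' n z).2)
        have h2 := Real.exp_pos (-F n z)
        constructor <;> linarith
      · rw [Set.indicator_of_notMem hz, hFA n z hz]
        simp only [neg_zero, Real.exp_zero, sub_self, norm_zero, add_zero]
        linarith
    · exact ((Real.continuous_exp.comp continuous_neg).continuousAt.tendsto.comp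
        (hF z)).sub_const 1
  exact tendsto_nhds_unique hlim1 hlim2

end

section

/-! ### One-step analysis of simple random walk -/

/-- The sequence `x, Y_0, Y_1, …`. -/
def pathCons {α : Type*} (x : α) (Y : ℕ → α) : ℕ → α
  | 0 => x
  | n + 1 => Y n

@[simp] lemma pathCons_zero {α : Type*} (x : α) (Y : ℕ → α) : pathCons x Y 0 = x := rfl

@[simp] lemma pathCons_succ {α : Type*} (x : α) (Y : ℕ → α) (n : ℕ) :
    pathCons x Y (n + 1) = Y n := rfl

lemma measurable_pathCons_uncurry {α : Type*} [MeasurableSpace α] :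
    Measurable fun p : α × (ℕ → α) => pathCons p.1 p.2 :=
  measurable_pi_iff.2 fun n => by
    cases n with
    | zero => exact measurable_fst
    | succ n => exact (measurable_pi_apply n).comp measurable_snd

lemma measurable_pathCons {α : Type*} [MeasurableSpace α] (x : α) :
    Measurable (pathCons x) :=
  measurable_pathCons_uncurry.comp measurable_prodMk_left

/-- An i.i.d. sequence with an independent copy of its entries put in front is again i.i.d.; this is
the source of the Markov property. -/
lemma map_pathCons_prod_infinitePi {α : Type*} [MeasurableSpace α] (μ : Measure α)
    [IsProbabilityMeasure μ] :
    (μ.prod (Measure.infinitePi fun _ : ℕ => μ)).map (fun p => pathCons p.1 p.2) =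
      Measure.infinitePi fun _ : ℕ => μ := by
  classical
  refine Measure.eq_infinitePi _ fun s t ht => ?_
  obtain ⟨m, hm⟩ := s.exists_nat_subset_range
  have hs : s ⊆ Finset.range (m + 1) := hm.trans (Finset.range_mono (Nat.le_succ m))
  -- Padding with the whole space turns a cylinder over `s` into one over an initial segment, from
  -- which coordinate `0` splits off.
  let t' : ℕ → Set α := fun i => if i ∈ s then t i else Set.univ
  have ht' : ∀ i, MeasurableSet (t' i) := fun i => by
    simp only [t']; split_ifs
    exacts [ht i, .univ]
  have e1 : Set.pi (s : Set ℕ) t = Set.pi (Finset.range (m + 1) : Set ℕ) t' := by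
    ext x
    simp only [Set.mem_pi, Finset.mem_coe, t']
    refine ⟨fun h i _ => ?_, fun h i hi => ?_⟩
    · split_ifs with hi
      exacts [h i hi, trivial]
    · simpa [hi] using h i (hs hi)
  have e2 : ∏ i ∈ s, μ (t i) = ∏ i ∈ Finset.range (m + 1), μ (t' i) := by
    rw [← Finset.prod_subset hs]
    · exact Finset.prod_congr rfl fun i hi => by simp [t', hi]
    · intro i _ hi
      simp [t', hi]
  have e3 : (fun p : α × (ℕ → α) => pathCons p.1 p.2) ⁻¹'
      (Set.pi (Finset.range (m + 1) : Set ℕ) t') =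
      t' 0 ×ˢ Set.pi (Finset.range m : Set ℕ) (fun i => t' (i + 1)) := by
    ext p
    simp only [Set.mem_preimage, Set.mem_pi, Finset.coe_range, Set.mem_Iio, Set.mem_prod]
    refine ⟨fun h => ⟨h 0 (by omega), fun i hi => h (i + 1) (by omega)⟩, fun h i hi => ?_⟩
    cases i with
    | zero => exact h.1
    | succ i => exact h.2 i (by omega)
  rw [e1, e2, Measure.map_apply measurable_pathCons_uncurry
    (MeasurableSet.pi (Finset.countable_toSet _) fun i _ => ht' i), e3, Measure.prod_prod,
    Measure.infinitePi_pi _ (fun i _ => ht' (i + 1)), Finset.prod_range_succ', mul_comm]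

variable {d : ℕ}

lemma walk_pathCons (x ξ₀ : Lattice d) (ξ : ℕ → Lattice d) :
    walk x (pathCons ξ₀ ξ) = pathCons x (walk (x + ξ₀) ξ) := by
  funext n
  cases n with
  | zero => simp [walk]
  | succ n => simp [walk, Finset.sum_range_succ', add_comm, add_left_comm]

lemma measurable_walk (x : Lattice d) : Measurable (walk x) :=
  measurable_pi_iff.2 fun _ =>
    measurable_const.add (Finset.measurable_sum _ fun k _ => measurable_pi_apply k)

/-- The average of `f` over the neighbours of `x`. -/
def stepAvg (f : Lattice d → ℝ) (x : Lattice d) : ℝ :=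
  (2 * d : ℝ)⁻¹ * ∑ s : Fin d × Bool, f (x + unitVector s)

lemma two_mul_dim_inv_toReal : ((2 * d : ℝ≥0∞)⁻¹).toReal = (2 * d : ℝ)⁻¹ := by
  simp [ENNReal.toReal_inv]

lemma stepAvg_sub (f g : Lattice d → ℝ) (x : Lattice d) :
    stepAvg (fun z => f z - g z) x = stepAvg f x - stepAvg g x := by
  simp [stepAvg, Finset.sum_sub_distrib, mul_sub]

lemma stepAvg_const_mul (c : ℝ) (f : Lattice d → ℝ) (x : Lattice d) :
    stepAvg (fun z => c * f z) x = c * stepAvg f x := by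
  simp only [stepAvg, ← Finset.mul_sum]
  ring

lemma stepAvg_mul_const (f : Lattice d → ℝ) (c : ℝ) (x : Lattice d) :
    stepAvg (fun z => f z * c) x = stepAvg f x * c := by
  simp only [stepAvg, ← Finset.sum_mul]
  ring

lemma stepAvg_sum {ι : Type*} (s : Finset ι) (f : ι → Lattice d → ℝ) (x : Lattice d) :
    stepAvg (fun z => ∑ i ∈ s, f i z) x = ∑ i ∈ s, stepAvg (f i) x := by
  simp only [stepAvg]
  rw [Finset.sum_comm, Finset.mul_sum]

lemma stepAvg_mono {f g : Lattice d → ℝ} (h : ∀ x, f x ≤ g x) (x : Lattice d) :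
    stepAvg f x ≤ stepAvg g x :=
  mul_le_mul_of_nonneg_left (Finset.sum_le_sum fun s _ => h _) (by positivity)

lemma stepAvg_nonneg {f : Lattice d → ℝ} (h : ∀ x, 0 ≤ f x) (x : Lattice d) : 0 ≤ stepAvg f x :=
  mul_nonneg (by positivity) (Finset.sum_nonneg fun _ _ => h _)

lemma abs_stepAvg_le (f : Lattice d → ℝ) (x : Lattice d) :
    |stepAvg f x| ≤ stepAvg (fun z => |f z|) x := by
  rw [stepAvg, abs_mul, abs_of_nonneg (by positivity : (0 : ℝ) ≤ (2 * d : ℝ)⁻¹)]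
  exact mul_le_mul_of_nonneg_left (Finset.abs_sum_le_sum_abs _ _) (by positivity)

lemma stepAvg_tendsto {f : ℕ → Lattice d → ℝ} {g : Lattice d → ℝ}
    (h : ∀ x, Filter.Tendsto (fun n => f n x) Filter.atTop (nhds (g x))) (x : Lattice d) :
    Filter.Tendsto (fun n => stepAvg (f n) x) Filter.atTop (nhds (stepAvg g x)) :=
  (tendsto_finsetSum _ fun _ _ => h _).const_mul _

lemma hasSum_stepAvg {f : ℕ → Lattice d → ℝ} {g : Lattice d → ℝ}
    (h : ∀ x, HasSum (fun n => f n x) (g x)) (x : Lattice d) :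
    HasSum (fun n => stepAvg (f n) x) (stepAvg g x) :=
  (hasSum_sum fun s _ => h (x + unitVector s)).mul_left _

lemma unitVector_not (s : Fin d × Bool) : unitVector (s.1, !s.2) = -unitVector s := by
  obtain ⟨i, b⟩ := s
  cases b <;> simp [unitVector, ← Pi.single_neg]

lemma sum_unitVector_neg {M : Type*} [AddCommMonoid M] (f : Lattice d → M) :
    ∑ s : Fin d × Bool, f (-unitVector s) = ∑ s : Fin d × Bool, f (unitVector s) := by
  simp_rw [← unitVector_not]
  exact ((Equiv.refl (Fin d)).prodCongr Equiv.boolNot).sum_comp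
    (fun s : Fin d × Bool => f (unitVector s))

variable [NeZero d]

instance (x : Lattice d) : IsProbabilityMeasure (walkLaw x) :=
  Measure.isProbabilityMeasure_map (measurable_walk x).aemeasurable

lemma stepLaw_eq : stepLaw d =
    (2 * d : ℝ≥0∞)⁻¹ • ∑ s : Fin d × Bool, Measure.dirac (unitVector s) := by
  ext A hA
  have hm : Measurable (unitVector : Fin d × Bool → Lattice d) := .of_discrete
  rw [stepLaw, PMF.toMeasure_map_apply _ _ _ hm hA, PMF.toMeasure_apply_fintype]
  simp only [Measure.smul_apply, Measure.finsetSum_apply,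
    smul_eq_mul, Finset.mul_sum, Measure.dirac_apply' _ hA]
  refine Finset.sum_congr rfl fun s _ => ?_
  by_cases h : unitVector s ∈ A <;> simp [Set.indicator, h, mul_comm]

lemma lintegral_stepLaw (f : Lattice d → ℝ≥0∞) :
    ∫⁻ z, f z ∂stepLaw d = (2 * d : ℝ≥0∞)⁻¹ * ∑ s : Fin d × Bool, f (unitVector s) := by
  rw [stepLaw_eq, lintegral_smul_measure, lintegral_finsetSum_measure]
  simp

/-- The Markov property at time `1`. -/
lemma walkLaw_eq (x : Lattice d) :
    walkLaw x = (2 * d : ℝ≥0∞)⁻¹ •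
      ∑ s : Fin d × Bool, (walkLaw (x + unitVector s)).map (pathCons x) := by
  ext A hA
  rw [walkLaw, Measure.map_apply (measurable_walk x) hA, ← map_pathCons_prod_infinitePi,
    Measure.map_apply measurable_pathCons_uncurry (measurable_walk x hA),
    Measure.prod_apply (measurable_pathCons_uncurry (measurable_walk x hA)), lintegral_stepLaw]
  simp only [Measure.smul_apply, Measure.finsetSum_apply, smul_eq_mul]
  congr 1
  refine Finset.sum_congr rfl fun s _ => ?_
  rw [Measure.map_apply (measurable_pathCons x) hA, walkLaw,
    Measure.map_apply (measurable_walk _) (measurable_pathCons x hA)]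
  congr 1
  ext ξ
  simp only [Set.mem_preimage, walk_pathCons]

lemma real_walkLaw (x : Lattice d) {A : Set (ℕ → Lattice d)} (hA : MeasurableSet A) :
    (walkLaw x).real A = (2 * d : ℝ)⁻¹ *
      ∑ s : Fin d × Bool, (walkLaw (x + unitVector s)).real (pathCons x ⁻¹' A) := by
  rw [Measure.real, walkLaw_eq, Measure.smul_apply, Measure.finsetSum_apply, smul_eq_mul,
    ENNReal.toReal_mul, two_mul_dim_inv_toReal, ENNReal.toReal_sum (fun s _ => measure_ne_top _ _)]
  congr 1
  refine Finset.sum_congr rfl fun s _ => ?_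
  rw [Measure.map_apply (measurable_pathCons x) hA, Measure.real]

lemma integral_walkLaw (x : Lattice d) {F : (ℕ → Lattice d) → ℝ} (hF : StronglyMeasurable F)
    (hi : ∀ s : Fin d × Bool, Integrable (fun Y => F (pathCons x Y)) (walkLaw (x + unitVector s))) :
    ∫ X, F X ∂walkLaw x = (2 * d : ℝ)⁻¹ *
      ∑ s : Fin d × Bool, ∫ Y, F (pathCons x Y) ∂walkLaw (x + unitVector s) := by
  rw [walkLaw_eq, integral_smul_measure, two_mul_dim_inv_toReal, smul_eq_mul,
    integral_finsetSum_measure]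
  · congr 1
    refine Finset.sum_congr rfl fun s _ => ?_
    rw [integral_map (measurable_pathCons x).aemeasurable hF.aestronglyMeasurable]
  · intro s _
    exact (integrable_map_measure hF.aestronglyMeasurable
      (measurable_pathCons x).aemeasurable).2 (hi s)

lemma ae_walkLaw (x : Lattice d) {p : (ℕ → Lattice d) → Prop} (hp : MeasurableSet {X | p X}) :
    (∀ᵐ X ∂walkLaw x, p X) ↔
      ∀ s : Fin d × Bool, ∀ᵐ Y ∂walkLaw (x + unitVector s), p (pathCons x Y) := by
  rw [ae_iff, walkLaw_eq, Measure.smul_apply, Measure.finsetSum_apply, smul_eq_mul,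
    mul_eq_zero, or_iff_right (ENNReal.inv_ne_zero.2 (by finiteness)), Finset.sum_eq_zero_iff]
  refine forall_congr' fun s => ?_
  rw [Measure.map_apply (measurable_pathCons x) (s := {X | ¬p X}) hp.compl, ae_iff]
  simp only [Finset.mem_univ, forall_const]
  rfl

lemma stepAvg_const (c : ℝ) (x : Lattice d) : stepAvg (fun _ => c) x = c := by
  have : (d : ℝ) ≠ 0 := NeZero.ne _
  simp [stepAvg]
  field_simp

/-! ### Transition probabilities -/

/-- The `n`-step transition probabilities `P_x[X_n = y]`. -/
def trans (n : ℕ) (x y : Lattice d) : ℝ := (walkLaw x).real {X | X n = y}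

lemma measurableSet_coord {α : Type*} [MeasurableSpace α] [Countable α]
    [MeasurableSingletonClass α] (n : ℕ) (S : Set α) : MeasurableSet {X : ℕ → α | X n ∈ S} :=
  measurable_pi_apply n S.to_countable.measurableSet

lemma measurableSet_coord_eq {α : Type*} [MeasurableSpace α] [Countable α]
    [MeasurableSingletonClass α] (n : ℕ) (y : α) : MeasurableSet {X : ℕ → α | X n = y} :=
  measurableSet_coord n {y}

lemma trans_nonneg (n : ℕ) (x y : Lattice d) : 0 ≤ trans n x y := measureReal_nonneg

lemma trans_zero (x y : Lattice d) : trans 0 x y = if x = y then 1 else 0 := by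
  have : walk x ⁻¹' {X | X 0 = y} = if x = y then Set.univ else ∅ := by
    ext ξ
    simp [walk]
  rw [trans, Measure.real, walkLaw, Measure.map_apply (measurable_walk x)
    (measurableSet_coord_eq 0 y), this]
  split_ifs <;> simp

lemma trans_succ (n : ℕ) (x y : Lattice d) :
    trans (n + 1) x y = stepAvg (fun z => trans n z y) x := by
  rw [trans, real_walkLaw x (measurableSet_coord_eq (n + 1) y)]
  rfl

lemma trans_add_right (n : ℕ) (x y z : Lattice d) : trans n (x + z) (y + z) = trans n x y := by
  induction n generalizing x with
  | zero => simp [trans_zero]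
  | succ n ih =>
    rw [trans_succ, trans_succ, stepAvg, stepAvg]
    simp_rw [add_right_comm x z, ih]

lemma trans_eq_sub (n : ℕ) (x y : Lattice d) : trans n x y = trans n (x - y) 0 := by
  have := trans_add_right n (x - y) 0 y
  simpa using this

/-- By translation invariance it suffices that `trans n z 0` is even in `z`, which follows by
induction from the symmetry of the set of unit vectors. -/
lemma trans_symm (n : ℕ) (x y : Lattice d) : trans n x y = trans n y x := by
  have h : ∀ n (z : Lattice d), trans n (-z) 0 = trans n z 0 := by
    intro n
    induction n with
    | zero => intro z; simp [trans_zero]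
    | succ n ih =>
      intro z
      rw [trans_succ, trans_succ, stepAvg, stepAvg]
      congr 1
      rw [← sum_unitVector_neg fun e => trans n (-z + e) 0]
      refine Finset.sum_congr rfl fun s _ => ?_
      rw [← ih, neg_add_rev, neg_neg, neg_neg, add_comm]
  rw [trans_eq_sub n x, trans_eq_sub n y, ← h, neg_sub]

lemma green_eq_tsum (x y : Lattice d) : green x y = ∑' n, trans n x y := rfl

lemma green_symm (x y : Lattice d) : green x y = green y x := by
  simp_rw [green_eq_tsum, trans_symm _ x y]

lemma green_nonneg (x y : Lattice d) : 0 ≤ green x y :=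
  tsum_nonneg fun n => trans_nonneg n x y

end

section

/-! ### Transience -/

/-- A Taylor bound with a generous quartic coefficient. Squaring the left side leaves only functions
of `w = y ^ 2`, namely `2 / (1 - w) + 2 / √(1 - w)`, each bounded by a polynomial. -/
lemma inv_sqrt_one_add_add_le {y : ℝ} (hy : y ^ 2 ≤ 1 / 4) :
    1 / √(1 + y) + 1 / √(1 - y) ≤ 2 + 3 / 4 * y ^ 2 + 2 * y ^ 4 := by
  have hy1 : |y| ≤ 1 / 2 := abs_le_of_sq_le_sq (by linarith) (by norm_num)
  obtain ⟨hl, hr⟩ := abs_le.1 hy1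
  have hp : 0 < 1 + y := by linarith
  have hm : 0 < 1 - y := by linarith
  set w := y ^ 2 with hw
  have hw0 : 0 ≤ w := sq_nonneg y
  have hw4 : y ^ 4 = w ^ 2 := by rw [hw]; ring
  have hz : 0 < 1 - w := by linarith
  have hz' : (1 + y) * (1 - y) = 1 - w := by rw [hw]; ring
  have h1 : 1 / √(1 - w) ≤ 1 + w / 2 + w ^ 2 := by
    rw [div_le_iff₀ (Real.sqrt_pos.2 hz)]
    have : Real.sqrt 1 ≤ √((1 + w / 2 + w ^ 2) ^ 2 * (1 - w)) := by
      apply Real.sqrt_le_sqrt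
      nlinarith [mul_nonneg hw0 hw0, mul_nonneg (mul_nonneg hw0 hw0) hw0,
        mul_nonneg (mul_nonneg (mul_nonneg hw0 hw0) hw0) hw0]
    rwa [Real.sqrt_one, Real.sqrt_mul (by positivity), Real.sqrt_sq (by positivity)] at this
  have h2 : 1 / (1 - w) ≤ 1 + w + 2 * w ^ 2 := by
    rw [div_le_iff₀ hz]
    nlinarith [mul_nonneg hw0 hw0]
  have h3 : (1 / √(1 + y) + 1 / √(1 - y)) ^ 2 = 2 * (1 / (1 - w)) + 2 * (1 / √(1 - w)) := by
    rw [← hz', Real.sqrt_mul hp.le, add_sq, div_pow, div_pow, Real.sq_sqrt hp.le,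
      Real.sq_sqrt hm.le]
    have := (Real.sqrt_pos.2 hp).ne'
    have := (Real.sqrt_pos.2 hm).ne'
    field_simp
    ring
  refine (sq_le_sq₀ (by positivity) (by positivity)).1 ?_
  rw [h3, hw4]
  nlinarith [mul_nonneg hw0 hw0, mul_nonneg (mul_nonneg hw0 hw0) hw0]

/-- With `q = a² + b² + c² + 20` and `t = q + 1`, the values of `q` at the six neighbours are `t ±
2a`, `t ± 2b`, `t ± 2c`, and `t - 1` is its value at the centre. After division by `√t`, both sides
have the terms `6 + 3 / t`, the critical balance of dimension three. At the next order the shift by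
`21` contributes `-63 / t²` against at most `32 / t²` from the quartic terms, leaving `-31 / t²`. -/
lemma sum_inv_sqrt_lt {a b c : ℝ} {t : ℝ} (ht : t = a ^ 2 + b ^ 2 + c ^ 2 + 21) :
    (1 / √(t + 2 * a) + 1 / √(t - 2 * a)) + (1 / √(t + 2 * b) + 1 / √(t - 2 * b)) +
      (1 / √(t + 2 * c) + 1 / √(t - 2 * c)) < 6 * (1 / √(t - 1)) := by
  have ha := sq_nonneg a
  have hb := sq_nonneg b
  have hc := sq_nonneg c
  have ht0 : 21 ≤ t := by linarith
  have htp : 0 < t := by linarith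
  have hst : 0 < √t := Real.sqrt_pos.2 htp
  have key : ∀ x : ℝ, x ^ 2 ≤ t - 21 →
      1 / √(t + 2 * x) + 1 / √(t - 2 * x) ≤
        (1 / √t) * (2 + 3 * x ^ 2 / t ^ 2 + 32 * x ^ 4 / t ^ 4) := by
    intro x hx
    have hy : (2 * x / t) ^ 2 ≤ 1 / 4 := by
      rw [div_pow, div_le_iff₀ (by positivity)]
      nlinarith
    have h := inv_sqrt_one_add_add_le hy
    have e1 : t + 2 * x = t * (1 + 2 * x / t) := by field_simp
    have e2 : t - 2 * x = t * (1 - 2 * x / t) := by field_simp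
    rw [e1, e2, Real.sqrt_mul htp.le, Real.sqrt_mul htp.le]
    have e3 : ∀ z : ℝ, 1 / (√t * z) = (1 / √t) * (1 / z) := fun z => by
      rw [one_div_mul_one_div]
    rw [e3, e3, ← mul_add]
    refine mul_le_mul_of_nonneg_left (h.trans_eq ?_) (by positivity)
    field_simp
    ring
  have h4 : a ^ 4 + b ^ 4 + c ^ 4 ≤ t ^ 2 := by
    nlinarith [mul_nonneg ha hb, mul_nonneg ha hc, mul_nonneg hb hc]
  have hroot : (1 / √t) * (1 + 1 / (2 * t)) ≤ 1 / √(t - 1) := by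
    have h1 : 0 < √(t - 1) := Real.sqrt_pos.2 (by linarith)
    rw [le_div_iff₀ h1, ← sq_le_sq₀ (by positivity) (by norm_num), mul_pow, mul_pow, div_pow,
      Real.sq_sqrt htp.le, Real.sq_sqrt (by linarith)]
    have : (1 + 1 / (2 * t)) ^ 2 = 1 + 1 / t + 1 / (4 * t ^ 2) := by field_simp; ring
    rw [this]
    have h2 : 1 ^ 2 / t * (1 + 1 / t + 1 / (4 * t ^ 2)) * (t - 1) =
        1 - (3 * t + 1) / (4 * t ^ 3) := by field_simp; ring
    rw [h2]
    have : 0 ≤ (3 * t + 1) / (4 * t ^ 3) := by positivity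
    linarith
  calc _ ≤ (1 / √t) * (2 + 3 * a ^ 2 / t ^ 2 + 32 * a ^ 4 / t ^ 4) +
          (1 / √t) * (2 + 3 * b ^ 2 / t ^ 2 + 32 * b ^ 4 / t ^ 4) +
          (1 / √t) * (2 + 3 * c ^ 2 / t ^ 2 + 32 * c ^ 4 / t ^ 4) :=
        add_le_add (add_le_add (key a (by linarith)) (key b (by linarith))) (key c (by linarith))
    _ = (1 / √t) * (6 + 3 * (t - 21) / t ^ 2 + 32 * (a ^ 4 + b ^ 4 + c ^ 4) / t ^ 4) := by
        rw [show t - 21 = a ^ 2 + b ^ 2 + c ^ 2 by linarith]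
        ring
    _ ≤ (1 / √t) * (6 + 3 * (t - 21) / t ^ 2 + 32 * t ^ 2 / t ^ 4) := by gcongr
    _ = (1 / √t) * (6 + 3 / t - 31 / t ^ 2) := by
        congr 1
        field_simp
        ring
    _ < (1 / √t) * (6 + 3 / t) := by
        have : 0 < 31 / t ^ 2 := by positivity
        exact mul_lt_mul_of_pos_left (by linarith) (by positivity)
    _ = 6 * ((1 / √t) * (1 + 1 / (2 * t))) := by ring
    _ ≤ _ := by linarith

variable {d : ℕ} [NeZero d]

/-- A positive, strictly superharmonic function on `ℤ^d`, for `d ≥ 3`. -/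
lemma exists_superharmonic (hd : 3 ≤ d) : ∃ f : Lattice d → ℝ,
    (∀ x, 0 ≤ f x ∧ f x ≤ 1) ∧ ∀ x, stepAvg f x < f x := by
  obtain ⟨m, rfl⟩ : ∃ m, d = m + 3 := ⟨d - 3, by omega⟩
  -- `1 / √q` is a smoothed Newtonian potential in three of the coordinates. A step in any other
  -- coordinate leaves it unchanged, so the inequality for six neighbours decides.
  let q : Lattice (m + 3) → ℝ := fun x => (x 0 : ℝ) ^ 2 + (x 1 : ℝ) ^ 2 + (x 2 : ℝ) ^ 2 + 20
  have hq : ∀ x, 1 ≤ q x := by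
    intro x
    simp only [q]
    linarith [sq_nonneg (x 0 : ℝ), sq_nonneg (x 1 : ℝ), sq_nonneg (x 2 : ℝ)]
  refine ⟨fun x => 1 / √(q x), fun x => ⟨by positivity, ?_⟩, fun x => ?_⟩
  · rw [div_le_one (Real.sqrt_pos.2 (by linarith [hq x])), Real.one_le_sqrt]
    exact hq x
  have h10 : (1 : Fin (m + 3)) ≠ 0 := by simp
  have h20 : (2 : Fin (m + 3)) ≠ 0 := by
    intro h
    have := congrArg Fin.val h
    rw [Fin.val_two] at this
    simp at this
  have h21 : (2 : Fin (m + 3)) ≠ 1 := by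
    intro h
    have := congrArg Fin.val h
    rw [Fin.val_two] at this
    simp at this
  let t : ℝ := q x + 1
  have hlt := sum_inv_sqrt_lt (a := x 0) (b := x 1) (c := x 2) (t := t) (by simp only [t, q]; ring)
  have hpos : (0 : ℝ) < 2 * (m + 3 : ℕ) := by positivity
  rw [stepAvg, inv_mul_lt_iff₀ hpos, Fintype.sum_prod_type]
  simp only [Fintype.sum_bool]
  have hval : ∀ i : Fin (m + 3), i = 0 ∨ i = 1 ∨ i = 2 →
      q (x + unitVector (i, true)) = t + 2 * x i ∧
      q (x + unitVector (i, false)) = t - 2 * x i := by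
    rintro i (rfl | rfl | rfl) <;>
      simp [q, t, unitVector, h10, h20, h21, h10.symm, h20.symm, h21.symm] <;>
      constructor <;> ring
  have hout : ∀ i : Fin (m + 3), i ≠ 0 → i ≠ 1 → i ≠ 2 → ∀ b,
      q (x + unitVector (i, b)) = q x := by
    intro i h0 h1 h2 b
    simp [q, unitVector, h0.symm, h1.symm, h2.symm]
  have hS : ({0, 1, 2} : Finset (Fin (m + 3))) ⊆ Finset.univ := Finset.subset_univ _
  have hcard : ({0, 1, 2} : Finset (Fin (m + 3))).card = 3 := by
    rw [Finset.card_insert_of_notMem, Finset.card_insert_of_notMem, Finset.card_singleton]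
    · simpa using h21.symm
    · simp [h20.symm]
  rw [← Finset.sum_sdiff hS]
  have e1 : ∑ i ∈ Finset.univ \ ({0, 1, 2} : Finset (Fin (m + 3))),
      (1 / √(q (x + unitVector (i, true))) + 1 / √(q (x + unitVector (i, false)))) =
      m * (2 * (1 / √(q x))) := by
    rw [Finset.sum_congr rfl (g := fun _ => 2 * (1 / √(q x)))]
    · rw [Finset.sum_const, Finset.card_sdiff_of_subset hS, hcard, Finset.card_univ,
        Fintype.card_fin, nsmul_eq_mul]
      simp
    · intro i hi
      simp only [Finset.mem_sdiff, Finset.mem_univ, true_and, Finset.mem_insert,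
        Finset.mem_singleton, not_or] at hi
      rw [hout i hi.1 hi.2.1 hi.2.2, hout i hi.1 hi.2.1 hi.2.2]
      ring
  rw [e1, Finset.sum_insert (by simp [h20.symm]),
    Finset.sum_insert (by simpa using h21.symm), Finset.sum_singleton,
    (hval 0 (by simp)).1, (hval 0 (by simp)).2, (hval 1 (by simp)).1, (hval 1 (by simp)).2,
    (hval 2 (by simp)).1, (hval 2 (by simp)).2]
  have et : t - 1 = q x := by simp [t]
  rw [et] at hlt
  push_cast
  linarith

/-- The Green function of simple random walk is finite and bounded in dimension at least `3`. -/
lemma exists_sum_trans_le (hd : 3 ≤ d) :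
    ∃ C : ℝ, ∀ (x y : Lattice d) (n : ℕ), ∑ k ∈ Finset.range n, trans k x y ≤ C := by
  obtain ⟨f, hf, hP⟩ := exists_superharmonic hd
  set δ := f 0 - stepAvg f 0 with hδ
  have hδ0 : 0 < δ := sub_pos.2 (hP 0)
  -- Averaging never increases `f` and lowers it by `δ` at the origin. Each expected visit to the
  -- origin therefore uses up `δ` of a supply that is at most `1`.
  have key : ∀ n x, ∑ k ∈ Finset.range n, trans k x 0 * δ ≤ f x := by
    intro n
    induction n with
    | zero => intro x; simpa using (hf x).1
    | succ n ih =>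
      intro x
      rw [Finset.sum_range_succ']
      have h1 : ∑ k ∈ Finset.range n, trans (k + 1) x 0 * δ ≤ stepAvg f x := by
        simp_rw [trans_succ, ← stepAvg_mul_const]
        rw [← stepAvg_sum]
        exact stepAvg_mono ih x
      rw [trans_zero]
      split_ifs with hx
      · subst hx; linarith
      · linarith [hP x]
  refine ⟨1 / δ, fun x y n => ?_⟩
  rw [le_div_iff₀ hδ0, Finset.sum_mul]
  simp_rw [trans_eq_sub _ x y]
  exact (key n (x - y)).trans (hf _).2

lemma summable_trans (hd : 3 ≤ d) (x y : Lattice d) : Summable fun n => trans n x y := by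
  obtain ⟨C, hC⟩ := exists_sum_trans_le hd
  exact summable_of_sum_range_le (fun n => trans_nonneg n x y) (hC x y)

lemma exists_green_le (hd : 3 ≤ d) : ∃ C : ℝ, ∀ x y : Lattice d, green x y ≤ C := by
  obtain ⟨C, hC⟩ := exists_sum_trans_le hd
  exact ⟨C, fun x y => Real.tsum_le_of_sum_range_le (fun n => trans_nonneg n x y) (hC x y)⟩

lemma green_eq (hd : 3 ≤ d) (x y : Lattice d) :
    green x y = (if x = y then 1 else 0) + stepAvg (fun z => green z y) x := by
  rw [green_eq_tsum, (summable_trans hd x y).tsum_eq_zero_add, trans_zero]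
  congr 1
  simp_rw [trans_succ]
  exact (hasSum_stepAvg (fun z => (summable_trans hd z y).hasSum) x).tsum_eq

/-! ### Potentials of finite sets and the uniqueness principle -/

/-- The expected number of visits to `K`. -/
def greenSum (K : Finset (Lattice d)) (x : Lattice d) : ℝ := ∑ y ∈ K, green x y

lemma greenSum_nonneg (K : Finset (Lattice d)) (x : Lattice d) : 0 ≤ greenSum K x :=
  Finset.sum_nonneg fun y _ => green_nonneg x y

lemma greenSum_eq (hd : 3 ≤ d) (K : Finset (Lattice d)) (x : Lattice d) :
    greenSum K x = (if x ∈ K then 1 else 0) + stepAvg (greenSum K) x := by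
  unfold greenSum
  rw [stepAvg_sum, Finset.sum_congr rfl fun y _ => green_eq hd x y, Finset.sum_add_distrib]
  simp

lemma one_le_greenSum (hd : 3 ≤ d) {K : Finset (Lattice d)} {x : Lattice d} (hx : x ∈ K) :
    1 ≤ greenSum K x := by
  rw [greenSum_eq hd, if_pos hx]
  linarith [stepAvg_nonneg (greenSum_nonneg K) x]

/-- A function dominated by a potential, whose absolute value is subharmonic, vanishes. -/
lemma eq_zero_of_abs_le_stepAvg (hd : 3 ≤ d) (K : Finset (Lattice d)) (C : ℝ) (u : Lattice d → ℝ)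
    (h1 : ∀ x, |u x| ≤ stepAvg (fun z => |u z|) x) (h2 : ∀ x, |u x| ≤ C * greenSum K x) :
    ∀ x, u x = 0 := by
  -- Iterating subharmonicity replaces the visits to `K` by the visits after time `n`, the tail of a
  -- convergent series.
  have key : ∀ n x, |u x| ≤ C * ∑ y ∈ K, ∑' k, trans (k + n) x y := by
    intro n
    induction n with
    | zero => exact h2
    | succ n ih =>
      intro x
      refine (h1 x).trans ((stepAvg_mono ih x).trans_eq ?_)
      rw [stepAvg_const_mul, stepAvg_sum]
      congr 1
      refine Finset.sum_congr rfl fun y _ => ?_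
      simp_rw [← add_assoc, trans_succ]
      exact (hasSum_stepAvg (fun z =>
        ((summable_nat_add_iff n).2 (summable_trans hd z y)).hasSum) x).tsum_eq.symm
  intro x
  have hlim : Filter.Tendsto (fun n => C * ∑ y ∈ K, ∑' k, trans (k + n) x y) Filter.atTop
      (nhds (C * ∑ y ∈ K, 0)) :=
    (tendsto_finsetSum _ fun y _ => tendsto_sum_nat_add fun k => trans k x y).const_mul C
  have := ge_of_tendsto hlim (Filter.Eventually.of_forall fun n => key n x)
  rw [Finset.sum_const_zero, mul_zero] at this
  exact abs_eq_zero.1 (le_antisymm this (abs_nonneg _))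

lemma abs_sum_green_mul_le (K : Finset (Lattice d)) (h : Lattice d → ℝ) (x : Lattice d) :
    |∑ y ∈ K, green x y * h y| ≤ (∑ y ∈ K, |h y|) * greenSum K x := by
  refine (Finset.abs_sum_le_sum_abs _ _).trans ?_
  rw [greenSum, Finset.mul_sum]
  refine Finset.sum_le_sum fun y hy => ?_
  rw [abs_mul, abs_of_nonneg (green_nonneg x y), mul_comm]
  exact mul_le_mul_of_nonneg_right
    (Finset.single_le_sum (f := fun y => |h y|) (fun z _ => abs_nonneg _) hy) (green_nonneg x y)

/-- A function dominated by a potential is the potential of its Laplacian. -/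
lemma eq_sum_green_mul (hd : 3 ≤ d) (K : Finset (Lattice d)) (C : ℝ) (u h : Lattice d → ℝ)
    (hh : ∀ x, x ∉ K → h x = 0) (hu : ∀ x, u x = h x + stepAvg u x)
    (hC : ∀ x, |u x| ≤ C * greenSum K x) (x : Lattice d) :
    u x = ∑ y ∈ K, green x y * h y := by
  have hG : ∀ x, ∑ y ∈ K, green x y * h y =
      h x + stepAvg (fun z => ∑ y ∈ K, green z y * h y) x := by
    intro x
    rw [stepAvg_sum]
    simp_rw [stepAvg_mul_const]
    rw [Finset.sum_congr rfl fun y _ => by rw [green_eq hd x y, add_mul], Finset.sum_add_distrib]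
    congr 1
    by_cases hx : x ∈ K
    · simp [hx]
    · simp [hx, hh x hx]
  -- The difference of two solutions is harmonic, and both are dominated by a multiple of `greenSum
  -- K`.
  have := eq_zero_of_abs_le_stepAvg hd K (C + ∑ y ∈ K, |h y|)
    (fun x => u x - ∑ y ∈ K, green x y * h y) (fun x => ?_) (fun x => ?_) x
  · exact sub_eq_zero.1 this
  · refine le_trans (le_of_eq ?_) (abs_stepAvg_le _ x)
    rw [stepAvg_sub]
    congr 1
    linarith [hu x, hG x]
  · rw [add_mul]
    exact (abs_sub _ _).trans (add_le_add (hC x) (abs_sum_green_mul_le K h x))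

end

section

/-! ### Equilibrium measure and capacity -/

variable {d : ℕ}

lemma measurableSet_hit (K : Finset (Lattice d)) :
    MeasurableSet {X : ℕ → Lattice d | ∃ n, X n ∈ K} := by
  rw [Set.ofPred_exists]
  exact .iUnion fun n => measurableSet_coord n (K : Set (Lattice d))

lemma measurableSet_neverReturns (K : Finset (Lattice d)) : MeasurableSet (neverReturns K) := by
  have : neverReturns K = ⋂ n : ℕ, {X : ℕ → Lattice d | X (n + 1) ∈ (K : Set (Lattice d))ᶜ} := by
    ext X
    simp only [neverReturns, Set.mem_ofPred_eq, Set.mem_iInter, Set.mem_compl_iff, Finset.mem_coe]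
    exact ⟨fun h n => h (n + 1) (by omega), fun h n hn => by
      obtain ⟨m, rfl⟩ := Nat.exists_eq_add_of_le' hn
      exact h m⟩
  rw [this]
  exact .iInter fun n => measurableSet_coord (n + 1) _

lemma pathCons_preimage_neverReturns (K : Finset (Lattice d)) (x : Lattice d) :
    pathCons x ⁻¹' neverReturns K = {X | ∃ n, X n ∈ K}ᶜ := by
  ext Y
  simp only [neverReturns, Set.mem_preimage, Set.mem_ofPred_eq, Set.mem_compl_iff, not_exists]
  exact ⟨fun h n => h (n + 1) (by omega), fun h n hn => by
    obtain ⟨m, rfl⟩ := Nat.exists_eq_add_of_le' hn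
    exact h m⟩

variable [NeZero d]

lemma tsum_walkLaw_coord_eq (hd : 3 ≤ d) (x y : Lattice d) :
    ∑' n, walkLaw x {X | X n = y} = ENNReal.ofReal (green x y) := by
  rw [green_eq_tsum, ENNReal.ofReal_tsum_of_nonneg (fun n => trans_nonneg n x y)
    (summable_trans hd x y)]
  exact tsum_congr fun n => (ofReal_measureReal (measure_ne_top _ _)).symm

lemma tsum_walkLaw_coord_mem_le (hd : 3 ≤ d) (K : Finset (Lattice d)) (x : Lattice d) :
    ∑' n, walkLaw x {X | X n ∈ K} ≤ ENNReal.ofReal (greenSum K x) := by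
  rw [greenSum, ENNReal.ofReal_sum_of_nonneg fun y _ => green_nonneg x y]
  simp_rw [← tsum_walkLaw_coord_eq hd]
  rw [← Summable.tsum_finsetSum fun _ _ => ENNReal.summable]
  refine ENNReal.tsum_le_tsum fun n => ?_
  refine (measure_mono fun X hX => ?_).trans (measure_biUnion_finset_le K _)
  exact Set.mem_biUnion (Finset.mem_coe.2 hX) rfl

lemma ae_finite_visits (hd : 3 ≤ d) (K : Finset (Lattice d)) (x : Lattice d) :
    ∀ᵐ X ∂walkLaw x, {n | X n ∈ K}.Finite :=
  ae_finite_setOfPred_mem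
    ((tsum_walkLaw_coord_mem_le hd K x).trans_lt ENNReal.ofReal_lt_top).ne

/-- The probability that the walk ever visits `K`. -/
def hitProb (K : Finset (Lattice d)) (x : Lattice d) : ℝ :=
  (walkLaw x).real {X | ∃ n, X n ∈ K}

lemma hitProb_nonneg (K : Finset (Lattice d)) (x : Lattice d) : 0 ≤ hitProb K x :=
  measureReal_nonneg

lemma hitProb_le_greenSum (hd : 3 ≤ d) (K : Finset (Lattice d)) (x : Lattice d) :
    hitProb K x ≤ greenSum K x := by
  refine ENNReal.toReal_le_of_le_ofReal (greenSum_nonneg K x)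
    (le_trans ?_ (tsum_walkLaw_coord_mem_le hd K x))
  rw [Set.ofPred_exists]
  exact measure_iUnion_le _

lemma real_neverReturns (K : Finset (Lattice d)) (x : Lattice d) :
    (walkLaw x).real (neverReturns K) = 1 - stepAvg (hitProb K) x := by
  rw [real_walkLaw x (measurableSet_neverReturns K), pathCons_preimage_neverReturns]
  simp_rw [probReal_compl_eq_one_sub (measurableSet_hit K)]
  have := stepAvg_sub (fun _ => 1) (hitProb K) x
  rw [stepAvg_const] at this
  exact this

lemma ae_walkLaw_zero (x : Lattice d) : ∀ᵐ X ∂walkLaw x, X 0 = x := by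
  rw [ae_walkLaw x (measurableSet_coord_eq 0 x)]
  exact fun s => ae_of_all _ fun Y => rfl

lemma hitProb_of_mem {K : Finset (Lattice d)} {x : Lattice d} (hx : x ∈ K) : hitProb K x = 1 := by
  have : walkLaw x {X | ∃ n, X n ∈ K} = 1 := by
    rw [← measure_univ (μ := walkLaw x)]
    refine measure_congr (Filter.eventuallyEq_set.2 ?_)
    filter_upwards [ae_walkLaw_zero x] with X hX
    simpa using ⟨0, hX ▸ hx⟩
  simp [hitProb, Measure.real, this]

lemma hitProb_of_notMem {K : Finset (Lattice d)} {x : Lattice d} (hx : x ∉ K) :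
    hitProb K x = stepAvg (hitProb K) x := by
  rw [hitProb, real_walkLaw x (measurableSet_hit K), stepAvg]
  congr 1
  refine Finset.sum_congr rfl fun s _ => ?_
  rw [hitProb]
  congr 1
  ext Y
  simp only [Set.mem_preimage, Set.mem_ofPred_eq]
  refine ⟨?_, fun ⟨n, hn⟩ => ⟨n + 1, hn⟩⟩
  rintro ⟨n, hn⟩
  cases n with
  | zero => exact absurd hn hx
  | succ n => exact ⟨n, hn⟩

/-- The last exit decomposition `G e_K = 1` on `K`. -/
lemma sum_green_mul_equilibrium (hd : 3 ≤ d) {K : Finset (Lattice d)} {x : Lattice d}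
    (hx : x ∈ K) : ∑ y ∈ K, green x y * (equilibrium K y).toReal = 1 := by
  -- The Laplacian of the hitting probability is `e_K`: on `K` by the definition of escape, off `K`
  -- by harmonicity. So `hitProb K` is the potential of `e_K`, and it equals one on `K`.
  have he : ∀ x, hitProb K x = (equilibrium K x).toReal + stepAvg (hitProb K) x := by
    intro x
    unfold equilibrium
    split_ifs with h
    · have := real_neverReturns K x
      rw [Measure.real] at this
      rw [this, hitProb_of_mem h]
      ring
    · rw [hitProb_of_notMem h]
      simp
  rw [← hitProb_of_mem hx]
  refine (eq_sum_green_mul hd K 1 (hitProb K) _ (fun y hy => by simp [equilibrium, hy]) he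
    (fun y => ?_) x).symm
  rw [one_mul, abs_of_nonneg (hitProb_nonneg K y)]
  exact hitProb_le_greenSum hd K y

/-! ### Positivity of the Green determinant -/

/-- The Green function of the walk killed with probability `1 - α` at each step. -/
def killedGreen (α : ℝ) (x y : Lattice d) : ℝ := ∑' n, α ^ n * trans n x y

lemma norm_pow_mul_trans_le {α : ℝ} (hα : α ∈ Set.Icc (0 : ℝ) 1) (n : ℕ) (x y : Lattice d) :
    ‖α ^ n * trans n x y‖ ≤ trans n x y := by
  rw [Real.norm_of_nonneg (mul_nonneg (pow_nonneg hα.1 n) (trans_nonneg n x y))]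
  exact mul_le_of_le_one_left (trans_nonneg n x y) (pow_le_one₀ hα.1 hα.2)

lemma summable_killedGreen (hd : 3 ≤ d) {α : ℝ} (hα : α ∈ Set.Icc (0 : ℝ) 1) (x y : Lattice d) :
    Summable fun n => α ^ n * trans n x y :=
  (summable_trans hd x y).of_norm_bounded fun n => norm_pow_mul_trans_le hα n x y

lemma abs_killedGreen_le (hd : 3 ≤ d) {α : ℝ} (hα : α ∈ Set.Icc (0 : ℝ) 1) (x y : Lattice d) :
    |killedGreen α x y| ≤ green x y :=
  tsum_of_norm_bounded (summable_trans hd x y).hasSum fun n => norm_pow_mul_trans_le hα n x y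

lemma killedGreen_eq (hd : 3 ≤ d) {α : ℝ} (hα : α ∈ Set.Icc (0 : ℝ) 1) (x y : Lattice d) :
    killedGreen α x y =
      (if x = y then 1 else 0) + α * stepAvg (fun z => killedGreen α z y) x := by
  rw [killedGreen, (summable_killedGreen hd hα x y).tsum_eq_zero_add, trans_zero, pow_zero, one_mul]
  congr 1
  simp_rw [trans_succ, pow_succ', mul_assoc]
  rw [tsum_mul_left]
  congr 1
  simp_rw [← stepAvg_const_mul]
  exact (hasSum_stepAvg (fun z => (summable_killedGreen hd hα z y).hasSum) x).tsum_eq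

/-- A null vector `v` produces a potential `u` that vanishes on `K` and satisfies `u = α stepAvg u`
elsewhere. Then `|u|` is subharmonic everywhere and dominated by `greenSum K`, so `u = 0`, and the
equation on `K` returns `v = 0`. -/
lemma det_killedGreen_ne_zero (hd : 3 ≤ d) (K : Finset (Lattice d)) {α : ℝ}
    (hα : α ∈ Set.Icc (0 : ℝ) 1) :
    (Matrix.of fun x y : K => killedGreen α x.1 y.1).det ≠ 0 := by
  intro h0
  obtain ⟨v, hv0, hv⟩ := Matrix.exists_mulVec_eq_zero_iff.2 h0
  let f : Lattice d → ℝ := fun x => if h : x ∈ K then v ⟨x, h⟩ else 0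
  let u : Lattice d → ℝ := fun x => ∑ y ∈ K, killedGreen α x y * f y
  have hfK : ∀ x : K, f x = v x := fun x => by simp [f]
  have huK : ∀ x ∈ K, u x = 0 := by
    intro x hx
    have := congrFun hv ⟨x, hx⟩
    simp only [Matrix.mulVec, dotProduct, Matrix.of_apply, Pi.zero_apply] at this
    simp only [u]
    rw [← Finset.sum_coe_sort, ← this]
    simp_rw [hfK]
  have hu : ∀ x, u x = f x + α * stepAvg u x := by
    intro x
    simp only [u]
    rw [stepAvg_sum, Finset.mul_sum]
    simp_rw [stepAvg_mul_const, ← mul_assoc]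
    rw [Finset.sum_congr rfl fun y _ => by rw [killedGreen_eq hd hα x y, add_mul],
      Finset.sum_add_distrib]
    congr 1
    by_cases hx : x ∈ K
    · simp [hx]
    · rw [show f x = 0 by simp [f, hx]]
      simp only [ite_mul, one_mul, zero_mul, Finset.sum_ite_eq, hx, if_false]
  have hzero := eq_zero_of_abs_le_stepAvg hd K (∑ y ∈ K, |f y|) u (fun x => ?_) (fun x => ?_)
  · refine hv0 (funext fun x => ?_)
    have h1 := hu x
    have h2 : stepAvg u x = 0 := by
      rw [show u = fun _ => 0 from funext hzero, stepAvg_const]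
    rw [hzero, h2, hfK] at h1
    simpa using h1.symm
  · by_cases hx : x ∈ K
    · rw [huK x hx, abs_zero]
      exact stepAvg_nonneg (fun _ => abs_nonneg _) x
    · refine le_trans ?_ (abs_stepAvg_le u x)
      rw [hu x, show f x = 0 by simp [f, hx], zero_add, abs_mul, abs_of_nonneg hα.1]
      exact mul_le_of_le_one_left (abs_nonneg _) hα.2
  · refine (Finset.abs_sum_le_sum_abs _ _).trans ?_
    rw [greenSum, Finset.mul_sum]
    refine Finset.sum_le_sum fun y hy => ?_
    rw [abs_mul, mul_comm]
    exact mul_le_mul (Finset.single_le_sum (f := fun y => |f y|) (fun z _ => abs_nonneg _) hy)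
      (abs_killedGreen_le hd hα x y) (abs_nonneg _) (Finset.sum_nonneg fun _ _ => abs_nonneg _)

lemma continuousOn_killedGreen (hd : 3 ≤ d) (x y : Lattice d) :
    ContinuousOn (fun α => killedGreen α x y) (Set.Icc 0 1) :=
  continuousOn_tsum (fun n => ((continuous_pow n).mul continuous_const).continuousOn)
    (summable_trans hd x y) fun n _ hα => norm_pow_mul_trans_le hα n x y

lemma killedGreen_zero (x y : Lattice d) : killedGreen 0 x y = if x = y then 1 else 0 := by
  rw [killedGreen, tsum_eq_single 0, trans_zero, pow_zero, one_mul]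
  intro n hn
  simp [hn]

lemma killedGreen_one (x y : Lattice d) : killedGreen 1 x y = green x y := by
  simp [killedGreen, green_eq_tsum]

/-- Deformation of the killing parameter: the determinant is `1` at `α = 0`, where the matrix is the
identity, depends continuously on `α` and never vanishes, so it is still positive at `α = 1`. -/
theorem greenDet_pos (hd : 3 ≤ d) (I : Finset (Lattice d)) : 0 < greenDet I := by
  let D : ℝ → ℝ := fun α => (Matrix.of fun x y : I => killedGreen α x.1 y.1).det
  have hcont : ContinuousOn D (Set.Icc 0 1) := by
    rw [continuousOn_iff_continuous_domRestrict]
    refine Continuous.matrix_det (A := fun α : Set.Icc (0 : ℝ) 1 =>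
      Matrix.of fun x y : I => killedGreen α.1 x.1 y.1) ?_
    exact continuous_matrix fun x y =>
      continuousOn_iff_continuous_domRestrict.1 (continuousOn_killedGreen hd x.1 y.1)
  have h0 : D 0 = 1 := by
    have : (Matrix.of fun x y : I => killedGreen 0 x.1 y.1) = 1 := by
      ext x y
      rw [Matrix.of_apply, killedGreen_zero, Matrix.one_apply]
      exact if_congr Subtype.ext_iff.symm rfl rfl
    simp only [D]
    rw [this, Matrix.det_one]
  have h1 : D 1 = greenDet I := by
    simp only [D, killedGreen_one]
    rfl
  rw [← h1]
  by_contra hc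
  obtain ⟨α, hα, hα0⟩ := intermediate_value_Icc' zero_le_one hcont
    (show (0 : ℝ) ∈ Set.Icc (D 1) (D 0) from ⟨not_lt.1 hc, by rw [h0]; exact zero_le_one⟩)
  exact det_killedGreen_ne_zero hd I hα hα0

/-- Applying the adjugate to `G e_I = 1` gives `adj(G) 1 = det(G) e_I`; the sum of the coordinates
is the claim. -/
theorem cofactorSum_div_greenDet (hd : 3 ≤ d) (I : Finset (Lattice d)) :
    cofactorSum I / greenDet I = capacity I := by
  have hdet := (greenDet_pos hd I).ne'
  have hG : (greenMatrix I).mulVec (fun y => (equilibrium I y.1).toReal) = 1 := by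
    ext x
    rw [Pi.one_apply, ← sum_green_mul_equilibrium hd x.2, ← Finset.sum_coe_sort]
    rfl
  have hadj : (greenMatrix I).adjugate.mulVec 1 =
      greenDet I • fun y : I => (equilibrium I y.1).toReal := by
    rw [← hG, Matrix.mulVec_mulVec, Matrix.adjugate_mul, Matrix.smul_mulVec, Matrix.one_mulVec]
    rfl
  rw [div_eq_iff hdet, cofactorSum, capacity, Finset.sum_mul, ← Finset.sum_coe_sort I]
  refine Finset.sum_comm.trans (Finset.sum_congr rfl fun x _ => ?_)
  have := congrFun hadj x
  simp only [Matrix.mulVec, dotProduct, Pi.one_apply, mul_one, Pi.smul_apply, smul_eq_mul] at this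
  rw [mul_comm, ← this]
  rfl

end

section

/-! ### Exponential holding times -/

lemma lintegral_exp_neg_expMeasure {a : ℝ} (ha : -1 < a) :
    ∫⁻ s, ENNReal.ofReal (Real.exp (-(a * s))) ∂expMeasure 1 = ENNReal.ofReal (1 + a)⁻¹ := by
  have h1 : 0 < 1 + a := by linarith
  have hm : Measurable (exponentialPDF 1) := (measurable_exponentialPDFReal 1).ennreal_ofReal
  have hm' : Measurable (exponentialPDF (1 + a)) :=
    (measurable_exponentialPDFReal (1 + a)).ennreal_ofReal
  change ∫⁻ s, ENNReal.ofReal (Real.exp (-(a * s))) ∂(volume.withDensity (exponentialPDF 1)) = _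
  rw [lintegral_withDensity_eq_lintegral_mul _ hm (by fun_prop)]
  have : ∀ s, (exponentialPDF 1 * fun s => ENNReal.ofReal (Real.exp (-(a * s)))) s =
      ENNReal.ofReal (1 + a)⁻¹ * exponentialPDF (1 + a) s := by
    intro s
    rw [Pi.mul_apply]
    rcases lt_or_ge s 0 with hs | hs
    · rw [exponentialPDF_of_neg hs, exponentialPDF_of_neg hs, zero_mul, mul_zero]
    · rw [exponentialPDF_of_nonneg hs, exponentialPDF_of_nonneg hs,
        ← ENNReal.ofReal_mul (by positivity), ← ENNReal.ofReal_mul (by positivity),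
        inv_mul_cancel_left₀ h1.ne', one_mul, ← Real.exp_add]
      congr 2
      ring
  simp_rw [this]
  rw [lintegral_const_mul _ hm', lintegral_exponentialPDF_eq_one h1, mul_one]

/-- The law of a sequence, indexed by `ℤ`, of i.i.d. exponential variables of parameter `1`. -/
def holdingLaw : Measure (ℤ → ℝ) := Measure.infinitePi fun _ : ℤ => expMeasure 1

instance : IsProbabilityMeasure holdingLaw := by
  unfold holdingLaw; infer_instance

/-- The injection `f` lets one computation serve nonnegative times and nonpositive times. -/
lemma lintegral_exp_neg_sum_holdingLaw {f : ℕ → ℤ} (hf : Function.Injective f) (a : ℕ → ℝ)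
    (ha : ∀ k, -1 < a k) (n : ℕ) :
    ∫⁻ σ, ENNReal.ofReal (Real.exp (-∑ k ∈ Finset.range n, a k * σ (f k))) ∂holdingLaw =
      ENNReal.ofReal (∏ k ∈ Finset.range n, (1 + a k)⁻¹) := by
  have hm : ∀ k, Measurable fun s : ℝ => ENNReal.ofReal (Real.exp (-(a k * s))) := fun k => by
    fun_prop
  have hi : iIndepFun (fun (k : ℕ) (σ : ℤ → ℝ) => σ (f k)) holdingLaw :=
    iIndepFun.precomp hf (iIndepFun_infinitePi (P := fun _ : ℤ => expMeasure 1)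
      (X := fun _ s => s) fun _ => measurable_id)
  have := lintegral_prod_eq_prod_lintegral_of_indepFun (Finset.range n) _ (hi.comp _ hm)
    fun k => (hm k).comp (measurable_pi_apply (f k))
  simp_rw [← Finset.sum_neg_distrib, Real.exp_sum,
    ENNReal.ofReal_prod_of_nonneg fun i _ => (Real.exp_pos _).le]
  rw [ENNReal.ofReal_prod_of_nonneg fun k _ => (inv_pos.2 (by linarith [ha k])).le]
  refine this.trans (Finset.prod_congr rfl fun k _ => ?_)
  rw [← lintegral_exp_neg_expMeasure (ha k),
    ← Measure.infinitePi_map_eval (fun _ : ℤ => expMeasure 1) (f k),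
    lintegral_map (hm k) (measurable_pi_apply (f k))]
  rfl

lemma ae_expMeasure_pos : ∀ᵐ s ∂expMeasure 1, 0 < s := by
  have : expMeasure 1 = volume.withDensity (exponentialPDF 1) := rfl
  have hm : Measurable (exponentialPDF 1) := (measurable_exponentialPDFReal 1).ennreal_ofReal
  rw [this, ae_withDensity_iff hm]
  filter_upwards [Measure.ae_ne volume (0 : ℝ)] with s hs h
  by_contra hc
  exact h (exponentialPDF_of_neg (lt_of_le_of_ne (not_lt.1 hc) hs))

lemma ae_holdingLaw_pos : ∀ᵐ σ ∂holdingLaw, ∀ n, 0 < σ n :=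
  ae_all_iff.2 fun n =>
    (measurePreserving_eval_infinitePi (fun _ : ℤ => expMeasure 1) n).quasiMeasurePreserving.ae
      ae_expMeasure_pos

/-- On the event that the total `S` is finite, `exp (-S)` has expectation at most that of `exp
(-S_n)`, which is `2⁻ⁿ` for every `n`. A positive function with zero integral on an event forces
that event to be null. -/
lemma ae_tsum_holdingLaw {f : ℕ → ℤ} (hf : Function.Injective f) :
    ∀ᵐ σ ∂holdingLaw, ∑' n, ENNReal.ofReal (σ (f n)) = ∞ := by
  -- Since `toReal` sends `∞` to `0`, the exponential would be `1` where the sum diverges; the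
  -- second factor removes that event.
  have h0 : ∫⁻ σ, ENNReal.ofReal (Real.exp (-(∑' n, ENNReal.ofReal (σ (f n))).toReal)) *
      (if ∑' n, ENNReal.ofReal (σ (f n)) = ∞ then 0 else 1) ∂holdingLaw = 0 := by
    refine le_antisymm (ge_of_tendsto' (x := Filter.atTop)
      (f := fun n : ℕ => ENNReal.ofReal ((1 + 1 : ℝ)⁻¹ ^ n)) ?_ fun n => ?_) zero_le
    · rw [← ENNReal.ofReal_zero]
      exact ENNReal.tendsto_ofReal
        (tendsto_pow_atTop_nhds_zero_of_lt_one (by norm_num) (by norm_num))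
    · have := lintegral_exp_neg_sum_holdingLaw hf (fun _ => 1) (fun _ => by norm_num) n
      rw [Finset.prod_const, Finset.card_range] at this
      rw [← this]
      refine lintegral_mono_ae ?_
      filter_upwards [ae_holdingLaw_pos] with σ hσ
      split_ifs with h
      · simp
      · rw [mul_one]
        refine ENNReal.ofReal_le_ofReal (Real.exp_le_exp.2 (neg_le_neg ?_))
        simp only [one_mul]
        rw [← ENNReal.ofReal_le_iff_le_toReal h,
          ENNReal.ofReal_sum_of_nonneg fun k _ => (hσ _).le]
        exact ENNReal.sum_le_tsum _
  rw [lintegral_eq_zero_iff] at h0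
  · filter_upwards [h0] with σ hσ
    by_contra h
    simp only [h, if_false, mul_one, Pi.zero_apply, ENNReal.ofReal_eq_zero] at hσ
    exact absurd hσ (not_le.2 (Real.exp_pos _))
  · have hm : Measurable fun σ : ℤ → ℝ => ∑' n, ENNReal.ofReal (σ (f n)) :=
      Measurable.tsum fun n => (measurable_pi_apply (f n)).ennreal_ofReal
    exact (hm.ennreal_toReal.neg.exp.ennreal_ofReal).mul
      (Measurable.ite (hm (measurableSet_singleton ∞)) measurable_const measurable_const)

/-! ### The Feynman–Kac formula -/

variable {d : ℕ}

/-- The time integral `∑_{n ≥ 0} V(X_n) σ_n` along a trajectory. -/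
def pathIntegral (V : Lattice d → ℝ) (p : (ℕ → Lattice d) × (ℤ → ℝ)) : ℝ :=
  ∑' n : ℕ, V (p.1 n) * p.2 n

lemma measurable_prod_inv (V : Lattice d → ℝ) (n : ℕ) :
    Measurable fun X : ℕ → Lattice d => ∏ k ∈ Finset.range n, (1 + V (X k))⁻¹ :=
  Finset.measurable_prod _ fun k _ =>
    (Measurable.of_discrete (f := fun z => (1 + V z)⁻¹)).comp (measurable_pi_apply k)

lemma measurable_partial_pathIntegral (V : Lattice d → ℝ) (n : ℕ) :
    Measurable fun p : (ℕ → Lattice d) × (ℤ → ℝ) => ∑ k ∈ Finset.range n, V (p.1 k) * p.2 k :=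
  Finset.measurable_sum _ fun k _ =>
    ((Measurable.of_discrete (f := V)).comp ((measurable_pi_apply k).comp measurable_fst)).mul
      ((measurable_pi_apply (k : ℤ)).comp measurable_snd)

lemma measurable_exp_neg_partial (V : Lattice d → ℝ) (n : ℕ) :
    Measurable fun p : (ℕ → Lattice d) × (ℤ → ℝ) =>
      Real.exp (-∑ k ∈ Finset.range n, V (p.1 k) * p.2 k) :=
  (measurable_partial_pathIntegral V n).neg.exp

lemma hasSum_pathIntegral {K : Finset (Lattice d)} {V : Lattice d → ℝ}
    (hV : ∀ x, x ∉ K → V x = 0) {p : (ℕ → Lattice d) × (ℤ → ℝ)} (hp : {n | p.1 n ∈ K}.Finite) :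
    HasSum (fun n : ℕ => V (p.1 n) * p.2 n) (pathIntegral V p) := by
  refine (summable_of_hasFiniteSupport (hp.subset fun n hn => ?_)).hasSum
  by_contra h
  exact hn (mul_eq_zero_of_left (hV _ h) _)

lemma norm_exp_neg_sum_le {V : Lattice d → ℝ} {p : (ℕ → Lattice d) × (ℤ → ℝ)}
    (hpos : ∀ n, 0 < p.2 n)
    (hs : HasSum (fun n : ℕ => max (-V (p.1 n)) 0 * p.2 n)
      (pathIntegral (fun x => max (-V x) 0) p)) (n : ℕ) :
    ‖Real.exp (-∑ k ∈ Finset.range n, V (p.1 k) * p.2 k)‖ ≤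
      Real.exp (pathIntegral (fun x => max (-V x) 0) p) := by
  rw [Real.norm_of_nonneg (Real.exp_pos _).le, Real.exp_le_exp, ← Finset.sum_neg_distrib]
  refine (Finset.sum_le_sum fun k _ => ?_).trans (sum_le_hasSum (Finset.range n)
    (fun k _ => mul_nonneg (le_max_right _ _) (hpos _).le) hs)
  rw [← neg_mul]
  exact mul_le_mul_of_nonneg_right (le_max_left _ _) (hpos _).le

variable [NeZero d]

/-- Potentials supported in `K` whose negative part is small relative to the Green function. -/
structure IsAdmissible (K : Finset (Lattice d)) (V : Lattice d → ℝ) : Prop where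
  eq_zero : ∀ x, x ∉ K → V x = 0
  neg_part_le : ∀ x, max (-V x) 0 * (1 + greenSum K x) ≤ 1

variable {K : Finset (Lattice d)} {V : Lattice d → ℝ}

/-- On `K` the Green sum is at least one, so the negative part of `V` is at most `1/2`. This keeps
`1 + V` away from zero and each `exp (-V σ)` integrable. -/
lemma IsAdmissible.neg_one_half_le (hd : 3 ≤ d) (hV : IsAdmissible K V) (x : Lattice d) :
    -(1 / 2) ≤ V x := by
  by_cases hx : x ∈ K
  · have h1 := one_le_greenSum hd hx
    have h2 := hV.neg_part_le x
    have h3 := le_max_left (-V x) 0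
    have h4 := le_max_right (-V x) 0
    nlinarith
  · rw [hV.eq_zero x hx]
    norm_num

lemma IsAdmissible.neg_part (hV : IsAdmissible K V) : IsAdmissible K fun x => -max (-V x) 0 where
  eq_zero x hx := by simp [hV.eq_zero x hx]
  neg_part_le x := by
    rw [neg_neg, max_eq_left (le_max_right _ _)]
    exact hV.neg_part_le x

/-- The expectation `E_x[∏_{k < n} (1 + V(X_k))⁻¹]`. -/
def fkPartial (V : Lattice d → ℝ) (n : ℕ) (x : Lattice d) : ℝ :=
  ∫ X, ∏ k ∈ Finset.range n, (1 + V (X k))⁻¹ ∂walkLaw x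

lemma IsAdmissible.prod_inv_mem (hd : 3 ≤ d) (hV : IsAdmissible K V) (n : ℕ)
    (X : ℕ → Lattice d) : 0 ≤ ∏ k ∈ Finset.range n, (1 + V (X k))⁻¹ ∧
      ∏ k ∈ Finset.range n, (1 + V (X k))⁻¹ ≤ 2 ^ n := by
  have h : ∀ x, 1 / 2 ≤ 1 + V x := fun x => by linarith [hV.neg_one_half_le hd x]
  refine ⟨Finset.prod_nonneg fun k _ => inv_nonneg.2 (by linarith [h (X k)]), ?_⟩
  refine (Finset.prod_le_prod (g := fun _ => 2)
    (fun k _ => inv_nonneg.2 (by linarith [h (X k)])) fun k _ => ?_).trans_eq (by simp)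
  rw [inv_le_comm₀ (by linarith [h (X k)]) two_pos]
  simpa using h (X k)

lemma IsAdmissible.integrable_prod_inv (hd : 3 ≤ d) (hV : IsAdmissible K V) (n : ℕ)
    (x : Lattice d) :
    Integrable (fun X => ∏ k ∈ Finset.range n, (1 + V (X k))⁻¹) (walkLaw x) :=
  Integrable.of_bound (measurable_prod_inv V n).aestronglyMeasurable (2 ^ n)
    (ae_of_all _ fun X => by
      rw [Real.norm_of_nonneg (hV.prod_inv_mem hd n X).1]
      exact (hV.prod_inv_mem hd n X).2)

lemma IsAdmissible.fkPartial_succ (hd : 3 ≤ d) (hV : IsAdmissible K V) (n : ℕ) (x : Lattice d) :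
    fkPartial V (n + 1) x = (1 + V x)⁻¹ * stepAvg (fkPartial V n) x := by
  have h : ∀ Y : ℕ → Lattice d, ∏ k ∈ Finset.range (n + 1), (1 + V (pathCons x Y k))⁻¹ =
      (1 + V x)⁻¹ * ∏ k ∈ Finset.range n, (1 + V (Y k))⁻¹ := fun Y => by
    rw [Finset.prod_range_succ', mul_comm]
    rfl
  rw [fkPartial, integral_walkLaw x (measurable_prod_inv V (n + 1)).stronglyMeasurable]
  · simp_rw [h, integral_const_mul, ← Finset.mul_sum]
    rw [mul_left_comm]
    rfl
  · intro s
    simp_rw [h]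
    exact (hV.integrable_prod_inv hd n _).const_mul _

/-- The bound is uniform in `n`, which later supplies both exponential moments and the domination
required by the uniqueness principle. With `u_n = 1 - fkPartial V n` and `g = greenSum K`, one has
`(1 + V) u_{n+1} = V + stepAvg u_n`, and averaging `C g` loses exactly `C` on `K`. Where `V ≥ 0`
this loss absorbs `V ≤ C`. Where `V < 0` one needs `|V| (1 + C g) ≤ C`, which follows from the
admissibility condition and `C ≥ 1`. -/
lemma IsAdmissible.abs_one_sub_fkPartial_le (hd : 3 ≤ d) (hV : IsAdmissible K V) (n : ℕ)
    (x : Lattice d) :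
    |1 - fkPartial V n x| ≤ (1 + ∑ y ∈ K, |V y|) * greenSum K x := by
  set C := 1 + ∑ y ∈ K, |V y| with hC
  have hC1 : 1 ≤ C := by
    have : 0 ≤ ∑ y ∈ K, |V y| := Finset.sum_nonneg fun y _ => abs_nonneg _
    linarith
  have hCV : ∀ x ∈ K, |V x| ≤ C := fun x hx => by
    have := Finset.single_le_sum (f := fun y => |V y|) (fun z _ => abs_nonneg _) hx
    linarith
  induction n generalizing x with
  | zero =>
    simp only [fkPartial, Finset.range_zero, Finset.prod_empty, integral_const, probReal_univ,
      smul_eq_mul, mul_one, sub_self, abs_zero]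
    exact mul_nonneg (by linarith) (greenSum_nonneg K x)
  | succ n ih =>
    have hp : 0 < 1 + V x := by linarith [hV.neg_one_half_le hd x]
    have e : (1 + V x) * (1 - fkPartial V (n + 1) x) =
        V x + stepAvg (fun z => 1 - fkPartial V n z) x := by
      rw [hV.fkPartial_succ hd, stepAvg_sub, stepAvg_const]
      field_simp
      ring
    have hS : stepAvg (fun z => C * greenSum K z) x =
        C * greenSum K x - if x ∈ K then C else 0 := by
      rw [stepAvg_const_mul, greenSum_eq hd K x]
      split_ifs <;> ring
    have h1 : |stepAvg (fun z => 1 - fkPartial V n z) x| ≤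
        C * greenSum K x - if x ∈ K then C else 0 := by
      rw [← hS]
      exact (abs_stepAvg_le _ x).trans (stepAvg_mono ih x)
    refine le_of_mul_le_mul_left ?_ hp
    rw [← abs_of_pos hp, ← abs_mul, abs_of_pos hp, e]
    refine (abs_add_le _ _).trans ((add_le_add le_rfl h1).trans ?_)
    have hg := greenSum_nonneg K x
    split_ifs with hx
    · rcases le_total 0 (V x) with h | h
      · have := hCV x hx
        nlinarith [mul_nonneg (mul_nonneg (by linarith : 0 ≤ C) hg) h]
      · rw [abs_of_nonpos h]
        have := hV.neg_part_le x
        rw [max_eq_left (by linarith)] at this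
        nlinarith [mul_le_mul_of_nonneg_left this (by linarith : 0 ≤ C)]
    · rw [hV.eq_zero x hx]
      simp

/-- The joint law of the walk and the holding times. -/
def markedLaw (x : Lattice d) : Measure ((ℕ → Lattice d) × (ℤ → ℝ)) :=
  (walkLaw x).prod holdingLaw

instance (x : Lattice d) : IsProbabilityMeasure (markedLaw x) := by
  unfold markedLaw; infer_instance

lemma ae_markedLaw_fst {x : Lattice d} {p : (ℕ → Lattice d) → Prop} (h : ∀ᵐ X ∂walkLaw x, p X) :
    ∀ᵐ q ∂markedLaw x, p q.1 :=
  Measure.quasiMeasurePreserving_fst.ae h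

lemma ae_markedLaw_snd {x : Lattice d} {p : (ℤ → ℝ) → Prop} (h : ∀ᵐ σ ∂holdingLaw, p σ) :
    ∀ᵐ q ∂markedLaw x, p q.2 :=
  Measure.quasiMeasurePreserving_snd.ae h

lemma ae_hasSum_pathIntegral (hd : 3 ≤ d) (hV : ∀ x, x ∉ K → V x = 0) (x : Lattice d) :
    ∀ᵐ p ∂markedLaw x, HasSum (fun n : ℕ => V (p.1 n) * p.2 n) (pathIntegral V p) := by
  filter_upwards [ae_markedLaw_fst (ae_finite_visits hd K x)] with p hp
  exact hasSum_pathIntegral hV hp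

lemma aemeasurable_pathIntegral (hd : 3 ≤ d) (hV : ∀ x, x ∉ K → V x = 0) (x : Lattice d) :
    AEMeasurable (pathIntegral V) (markedLaw x) :=
  aemeasurable_of_tendsto_metrizable_ae'
    (fun n => (measurable_partial_pathIntegral V n).aemeasurable)
    ((ae_hasSum_pathIntegral hd hV x).mono fun _ hp => hp.tendsto_sum_nat)

lemma IsAdmissible.lintegral_exp_neg_partial (hd : 3 ≤ d) (hV : IsAdmissible K V) (n : ℕ)
    (x : Lattice d) :
    ∫⁻ p, ENNReal.ofReal (Real.exp (-∑ k ∈ Finset.range n, V (p.1 k) * p.2 k)) ∂markedLaw x =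
      ENNReal.ofReal (fkPartial V n x) := by
  rw [markedLaw, lintegral_prod _
    (measurable_exp_neg_partial V n).ennreal_ofReal.aemeasurable, fkPartial,
    ofReal_integral_eq_lintegral_ofReal (hV.integrable_prod_inv hd n x)
      (ae_of_all _ fun X => (hV.prod_inv_mem hd n X).1)]
  refine lintegral_congr fun X => ?_
  exact lintegral_exp_neg_sum_holdingLaw Nat.cast_injective (fun k => V (X k))
    (fun k => by linarith [hV.neg_one_half_le hd (X k)]) n

/-- Fatou's lemma applied to the partial sums: their exponential moments are `fkPartial` for the
potential reduced to its negative part, bounded uniformly in `n`. -/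
lemma IsAdmissible.integrable_exp_neg_part (hd : 3 ≤ d) (hV : IsAdmissible K V) (x : Lattice d) :
    Integrable (fun p => Real.exp (pathIntegral (fun x => max (-V x) 0) p)) (markedLaw x) := by
  have hz : ∀ x, x ∉ K → max (-V x) 0 = 0 := fun x hx => by simp [hV.eq_zero x hx]
  refine ⟨(aemeasurable_pathIntegral hd hz x).exp.aestronglyMeasurable, ?_⟩
  rw [hasFiniteIntegral_iff_ofReal (ae_of_all _ fun ω => (Real.exp_pos _).le)]
  set C := (1 + ∑ y ∈ K, |(-max (-V y) 0)|) * greenSum K x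
  calc ∫⁻ p, ENNReal.ofReal (Real.exp (pathIntegral (fun x => max (-V x) 0) p)) ∂markedLaw x
      = ∫⁻ p, Filter.liminf (fun n : ℕ => ENNReal.ofReal
          (Real.exp (-∑ k ∈ Finset.range n, (-max (-V (p.1 k)) 0) * p.2 k))) Filter.atTop
          ∂markedLaw x := by
        refine lintegral_congr_ae ?_
        filter_upwards [ae_hasSum_pathIntegral hd hz x] with p hp
        have := ((ENNReal.continuous_ofReal.comp Real.continuous_exp).tendsto _).comp
          hp.tendsto_sum_nat
        simp only [neg_mul, Finset.sum_neg_distrib, neg_neg]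
        exact this.liminf_eq.symm
    _ ≤ Filter.liminf (fun n : ℕ => ∫⁻ p, ENNReal.ofReal
          (Real.exp (-∑ k ∈ Finset.range n, (-max (-V (p.1 k)) 0) * p.2 k)) ∂markedLaw x)
          Filter.atTop :=
        lintegral_liminf_le fun n =>
          (measurable_exp_neg_partial (fun x => -max (-V x) 0) n).ennreal_ofReal
    _ ≤ Filter.liminf (fun _ : ℕ => ENNReal.ofReal (1 + C)) Filter.atTop := by
        refine Filter.liminf_le_liminf (Filter.Eventually.of_forall fun n => ?_)
        have h := hV.neg_part.lintegral_exp_neg_partial hd n x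
        rw [h]
        refine ENNReal.ofReal_le_ofReal ?_
        have := (abs_le.1 (hV.neg_part.abs_one_sub_fkPartial_le hd n x)).1
        linarith
    _ = ENNReal.ofReal (1 + C) := Filter.liminf_const _
    _ < ∞ := ENNReal.ofReal_lt_top

/-- The Feynman–Kac functional `E_x[exp(-∑_n V(X_n) σ_n)]`. -/
def feynmanKac (V : Lattice d → ℝ) (x : Lattice d) : ℝ :=
  ∫ p, Real.exp (-pathIntegral V p) ∂markedLaw x

lemma IsAdmissible.integrable_exp_neg (hd : 3 ≤ d) (hV : IsAdmissible K V) (x : Lattice d) :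
    Integrable (fun p => Real.exp (-pathIntegral V p)) (markedLaw x) := by
  have hz : ∀ x, x ∉ K → max (-V x) 0 = 0 := fun x hx => by simp [hV.eq_zero x hx]
  refine (hV.integrable_exp_neg_part hd x).mono'
    (aemeasurable_pathIntegral hd hV.eq_zero x).neg.exp.aestronglyMeasurable ?_
  filter_upwards [ae_markedLaw_snd ae_holdingLaw_pos, ae_hasSum_pathIntegral hd hz x,
    ae_hasSum_pathIntegral hd hV.eq_zero x] with p h1 h2 h3
  have := ((Real.continuous_exp.comp continuous_neg).norm.tendsto _).comp h3.tendsto_sum_nat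
  exact le_of_tendsto this (Filter.Eventually.of_forall fun n => norm_exp_neg_sum_le h1 h2 n)

/-- Integrating out the holding times makes `fkPartial` the exponential moment of a partial sum;
dominated convergence applies with the negative part as bound. -/
lemma IsAdmissible.tendsto_fkPartial (hd : 3 ≤ d) (hV : IsAdmissible K V) (x : Lattice d) :
    Filter.Tendsto (fun n => fkPartial V n x) Filter.atTop (nhds (feynmanKac V x)) := by
  have hz : ∀ x, x ∉ K → max (-V x) 0 = 0 := fun x hx => by simp [hV.eq_zero x hx]
  have e : ∀ n, fkPartial V n x =
      ∫ p, Real.exp (-∑ k ∈ Finset.range n, V (p.1 k) * p.2 k) ∂markedLaw x := by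
    intro n
    rw [integral_eq_lintegral_of_nonneg_ae (ae_of_all _ fun p => (Real.exp_pos _).le)
      (measurable_exp_neg_partial V n).aestronglyMeasurable,
      hV.lintegral_exp_neg_partial hd, ENNReal.toReal_ofReal]
    exact integral_nonneg fun X => (hV.prod_inv_mem hd n X).1
  simp_rw [e]
  refine tendsto_integral_of_dominated_convergence _
    (fun n => (measurable_exp_neg_partial V n).aestronglyMeasurable)
    (hV.integrable_exp_neg_part hd x) (fun n => ?_) ?_
  · filter_upwards [ae_markedLaw_snd ae_holdingLaw_pos, ae_hasSum_pathIntegral hd hz x]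
      with p h1 h2 using norm_exp_neg_sum_le h1 h2 n
  · filter_upwards [ae_hasSum_pathIntegral hd hV.eq_zero x] with p hp
    exact ((Real.continuous_exp.comp continuous_neg).tendsto _).comp hp.tendsto_sum_nat

/-- The Feynman–Kac functional solves `(1 + G V) φ = 1`. -/
lemma IsAdmissible.feynmanKac_add (hd : 3 ≤ d) (hV : IsAdmissible K V) (x : Lattice d) :
    feynmanKac V x + ∑ y ∈ K, green x y * (V y * feynmanKac V y) = 1 := by
  -- The limit of the one-step recursion for `fkPartial`. It says that `1 - φ` has Laplacian `V φ`,
  -- supported in `K`.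
  have hstep : ∀ x, (1 + V x) * feynmanKac V x = stepAvg (feynmanKac V) x := by
    intro x
    have h1 := (hV.tendsto_fkPartial hd x).comp (Filter.tendsto_add_atTop_nat 1)
    have h2 := (stepAvg_tendsto (hV.tendsto_fkPartial hd) x).const_mul (1 + V x)⁻¹
    have h3 : (fun n => fkPartial V n x) ∘ (fun a => a + 1) =
        fun n => (1 + V x)⁻¹ * stepAvg (fkPartial V n) x :=
      funext fun n => hV.fkPartial_succ hd n x
    rw [h3] at h1
    rw [tendsto_nhds_unique h1 h2, mul_inv_cancel_left₀]
    linarith [hV.neg_one_half_le hd x]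
  have := eq_sum_green_mul hd K (1 + ∑ y ∈ K, |V y|) (fun x => 1 - feynmanKac V x)
    (fun x => V x * feynmanKac V x) (fun x hx => by simp [hV.eq_zero x hx])
    (fun x => by
      rw [stepAvg_sub, stepAvg_const, ← hstep]
      ring)
    (fun x => le_of_tendsto ((hV.tendsto_fkPartial hd x).const_sub 1).abs
      (Filter.Eventually.of_forall fun n => hV.abs_one_sub_fkPartial_le hd n x)) x
  linarith

end

section

/-! ### The measure on doubly infinite trajectories -/

variable {d : ℕ}

lemma sum_abs_unitVector (s : Fin d × Bool) : ∑ i, |unitVector s i| = 1 := by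
  obtain ⟨j, b⟩ := s
  rw [Finset.sum_eq_single j]
  · cases b <;> simp [unitVector]
  · intro i _ hi
    simp [unitVector, hi]
  · simp

lemma measurable_glue :
    Measurable (glue : (ℕ → Lattice d) × (ℕ → Lattice d) × (ℤ → ℝ) → MarkedPath d) := by
  refine measurable_pi_iff.2 fun n => Measurable.prodMk ?_ ?_
  · split_ifs
    · exact (measurable_pi_apply _).comp measurable_fst
    · exact (measurable_pi_apply _).comp (measurable_fst.comp measurable_snd)
  · exact (measurable_pi_apply n).comp (measurable_snd.comp measurable_snd)

lemma glue_natCast_fst (p : (ℕ → Lattice d) × (ℕ → Lattice d) × (ℤ → ℝ)) (n : ℕ) :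
    (glue p n).1 = p.1 n := by
  simp [glue]

lemma glue_neg_fst (p : (ℕ → Lattice d) × (ℕ → Lattice d) × (ℤ → ℝ)) (n : ℕ) :
    (glue p (-((n : ℤ) + 1))).1 = p.2.1 (n + 1) := by
  have h : ¬ (0 : ℤ) ≤ -((n : ℤ) + 1) := by omega
  simp only [glue, h, if_false, neg_neg]
  congr 1

lemma glue_snd (p : (ℕ → Lattice d) × (ℕ → Lattice d) × (ℤ → ℝ)) (n : ℤ) :
    (glue p n).2 = p.2.2 n := rfl

lemma eq_natCast_or_eq_neg (n : ℤ) : (∃ m : ℕ, n = m) ∨ ∃ m : ℕ, n = -((m : ℤ) + 1) := by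
  rcases le_or_gt 0 n with h | h
  · exact Or.inl ⟨n.toNat, by omega⟩
  · exact Or.inr ⟨(-n - 1).toNat, by omega⟩

/-- Nearest neighbour trajectories started at `x` which spend finite time in finite sets. -/
def IsTransientPath (x : Lattice d) (X : ℕ → Lattice d) : Prop :=
  X 0 = x ∧ (∀ n, ∑ i, |X (n + 1) i - X n i| = 1) ∧
    ∀ K : Finset (Lattice d), {n | X n ∈ K}.Finite

lemma glue_mem_trajectories {x : Lattice d} {p : (ℕ → Lattice d) × (ℕ → Lattice d) × (ℤ → ℝ)}
    (h1 : IsTransientPath x p.1) (h2 : IsTransientPath x p.2.1) (h3 : ∀ n, 0 < p.2.2 n)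
    (h4 : ∑' n : ℕ, ENNReal.ofReal (p.2.2 n) = ∞)
    (h5 : ∑' n : ℕ, ENNReal.ofReal (p.2.2 (-n)) = ∞) : glue p ∈ trajectories d := by
  refine ⟨fun n => ?_, fun K => ?_, h3, h4, h5⟩
  · rcases eq_natCast_or_eq_neg n with ⟨m, rfl⟩ | ⟨m, rfl⟩
    · have := glue_natCast_fst p (m + 1)
      push_cast at this
      rw [this, glue_natCast_fst]
      exact h1.2.1 m
    · rw [glue_neg_fst]
      cases m with
      | zero =>
        -- The junction: site `0` is read from the forward part and site `-1` from the backward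
        -- part, and both parts start at `x`.
        have := glue_natCast_fst p 0
        simp only [Nat.cast_zero, zero_add, neg_add_cancel] at this ⊢
        rw [this, h1.1, ← h2.1]
        simp_rw [abs_sub_comm (p.2.1 0 _)]
        exact h2.2.1 0
      | succ m =>
        have e : -(((m + 1 : ℕ) : ℤ) + 1) + 1 = -((m : ℤ) + 1) := by push_cast; ring
        rw [e, glue_neg_fst]
        simp_rw [abs_sub_comm (p.2.1 (m + 1) _)]
        exact h2.2.1 (m + 1)
  · refine (((h1.2.2 K).image fun n : ℕ => (n : ℤ)).union
      ((h2.2.2 K).image fun n : ℕ => -(n : ℤ))).subset fun n hn => ?_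
    rcases eq_natCast_or_eq_neg n with ⟨m, rfl⟩ | ⟨m, rfl⟩
    · exact Or.inl ⟨m, by simpa [glue_natCast_fst] using hn, rfl⟩
    · refine Or.inr ⟨m + 1, ?_, by push_cast; rfl⟩
      have : (glue p (-((m : ℤ) + 1))).1 ∈ K := hn
      rwa [glue_neg_fst] at this

/-- The time spent at `x` by a marked path. -/
def pathTimeSpent (x : Lattice d) (w : MarkedPath d) : ℝ≥0∞ :=
  ∑' n : ℤ, if (w n).1 = x then ENNReal.ofReal (w n).2 else 0

lemma measurable_pathTimeSpent (x : Lattice d) : Measurable (pathTimeSpent x) :=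
  Measurable.tsum fun n =>
    Measurable.ite ((measurable_pi_apply n).fst (measurableSet_singleton x))
      (measurable_pi_apply n).snd.ennreal_ofReal measurable_const

/-- The backward part is never in `K` after its starting time, so negative times contribute nothing
at sites of `K` and the two-sided sum collapses to the forward one. -/
lemma sum_mul_pathTimeSpent_glue {K : Finset (Lattice d)} {V : Lattice d → ℝ}
    (hV : ∀ x, x ∉ K → V x = 0) {p : (ℕ → Lattice d) × (ℕ → Lattice d) × (ℤ → ℝ)}
    (h1 : {n | p.1 n ∈ K}.Finite) (h2 : p.2.1 ∈ neverReturns K) (h3 : ∀ n, 0 < p.2.2 n) :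
    ∑ x ∈ K, V x * (pathTimeSpent x (glue p)).toReal = pathIntegral V (p.1, p.2.2) := by
  have key : ∀ x ∈ K, (pathTimeSpent x (glue p)).toReal =
      ∑' n : ℕ, if p.1 n = x then p.2.2 n else 0 := by
    intro x hx
    have e : pathTimeSpent x (glue p) =
        ∑' n : ℕ, if p.1 n = x then ENNReal.ofReal (p.2.2 n) else 0 := by
      rw [pathTimeSpent, ← (Nat.cast_injective (R := ℤ)).tsum_eq]
      · exact tsum_congr fun n => by rw [glue_natCast_fst, glue_snd]
      · intro n hn
        rcases eq_natCast_or_eq_neg n with ⟨m, rfl⟩ | ⟨m, rfl⟩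
        · exact ⟨m, rfl⟩
        · refine absurd ?_ hn
          refine if_neg fun h => ?_
          rw [glue_neg_fst] at h
          exact h2 (m + 1) (by omega) (h ▸ hx)
    rw [e, ENNReal.tsum_toReal_eq]
    · refine tsum_congr fun n => ?_
      split_ifs
      · exact ENNReal.toReal_ofReal (h3 _).le
      · rfl
    · intro n
      split_ifs <;> simp
  have hs : ∀ x ∈ K, Summable fun n : ℕ => V x * if p.1 n = x then p.2.2 n else 0 := by
    intro x hx
    refine summable_of_hasFiniteSupport (h1.subset fun n hn => ?_)
    by_contra h
    refine hn ?_
    have : p.1 n ≠ x := fun hh => h (show p.1 n ∈ K from hh ▸ hx)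
    simp [this]
  rw [Finset.sum_congr rfl fun x hx => by rw [key x hx, ← tsum_mul_left],
    ← Summable.tsum_finsetSum hs]
  refine tsum_congr fun n => ?_
  simp only [mul_ite, mul_zero, Finset.sum_ite_eq]
  split_ifs with h
  · rfl
  · rw [hV _ h, zero_mul]

lemma timeSpent_proj (x : Lattice d) (w : Trajectory d) :
    timeSpent x (proj w) = pathTimeSpent x w.1 := rfl

lemma measurable_proj : Measurable (proj : Trajectory d → TrajectoryClass d) :=
  fun _ hs => hs

lemma proj_mem_entering_iff (K : Finset (Lattice d)) (w : Trajectory d) :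
    proj w ∈ entering K ↔ ∃ n, (w.1 n).1 ∈ K := by
  refine ⟨?_, fun h => ⟨w, h, rfl⟩⟩
  rintro ⟨w', ⟨n, hn⟩, hw⟩
  obtain ⟨k, hk⟩ := Quotient.exact hw
  exact ⟨n + k, by rwa [← hk]⟩

lemma measurableSet_entering (K : Finset (Lattice d)) :
    MeasurableSet (entering K : Set (TrajectoryClass d)) := by
  refine measurableSet_quotient.2 ?_
  have : (Quotient.mk (shiftSetoid d)) ⁻¹' (entering K) =
      ⋃ n : ℤ, {w : Trajectory d | (w.1 n).1 ∈ K} := by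
    ext w
    rw [Set.mem_iUnion]
    exact proj_mem_entering_iff K w
  refine MeasurableSet.congr ?_ this.symm
  refine .iUnion fun n => ?_
  have h : Measurable fun w : Trajectory d => w.1 n :=
    (measurable_pi_apply n).comp measurable_subtype_coe
  exact h.fst (MeasurableSet.of_discrete (s := {y : Lattice d | y ∈ K}))

lemma timeSpent_eq_zero {K : Finset (Lattice d)} {x : Lattice d} (hx : x ∈ K)
    {w : TrajectoryClass d} (hw : w ∉ entering K) : timeSpent x w = 0 := by
  induction w using Quotient.inductionOn with
  | h w =>
    change proj w ∉ entering K at hw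
    change timeSpent x (proj w) = 0
    rw [proj_mem_entering_iff, not_exists] at hw
    rw [timeSpent_proj, pathTimeSpent, ENNReal.tsum_eq_zero]
    intro n
    rw [if_neg]
    exact fun h => hw n (h ▸ hx)

lemma timeSpent_lt_top (x : Lattice d) (w : TrajectoryClass d) : timeSpent x w < ∞ := by
  induction w using Quotient.inductionOn with
  | h w =>
    change pathTimeSpent x w.1 < ∞
    have hfin := w.2.2.1 {x}
    simp only [Finset.mem_singleton] at hfin
    rw [pathTimeSpent, tsum_eq_sum (s := hfin.toFinset)]
    · refine ENNReal.sum_lt_top.2 fun n _ => ?_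
      split_ifs <;> simp
    · intro n hn
      rw [if_neg]
      simpa using hn

/-- The integral of `V` along a trajectory modulo time shift. -/
def classIntegral (K : Finset (Lattice d)) (V : Lattice d → ℝ) (w : TrajectoryClass d) : ℝ :=
  ∑ x ∈ K, V x * (timeSpent x w).toReal

lemma measurable_classIntegral (K : Finset (Lattice d)) (V : Lattice d → ℝ) :
    Measurable (classIntegral K V) :=
  Finset.measurable_sum _ fun x _ => (measurable_timeSpent x).ennreal_toReal.const_mul _

lemma classIntegral_eq_zero {K : Finset (Lattice d)} (V : Lattice d → ℝ)
    {w : TrajectoryClass d} (hw : w ∉ entering K) : classIntegral K V w = 0 :=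
  Finset.sum_eq_zero fun x hx => by rw [timeSpent_eq_zero hx hw, ENNReal.toReal_zero, mul_zero]

variable [NeZero d]

lemma ae_walkLaw_nearest_neighbour (n : ℕ) (x : Lattice d) :
    ∀ᵐ X ∂walkLaw x, ∑ i, |X (n + 1) i - X n i| = 1 := by
  have hm : ∀ n, MeasurableSet {X : ℕ → Lattice d | ∑ i, |X (n + 1) i - X n i| = 1} := by
    intro n
    have h : Measurable fun X : ℕ → Lattice d => (X (n + 1), X n) :=
      (measurable_pi_apply (n + 1)).prodMk (measurable_pi_apply n)
    exact h (MeasurableSet.of_discrete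
      (s := {q : Lattice d × Lattice d | ∑ i, |q.1 i - q.2 i| = 1}))
  induction n generalizing x with
  | zero =>
    rw [ae_walkLaw x (hm 0)]
    intro s
    filter_upwards [ae_walkLaw_zero (x + unitVector s)] with Y hY
    simp only [pathCons_succ, pathCons_zero, hY, Pi.add_apply, add_sub_cancel_left]
    exact sum_abs_unitVector s
  | succ n ih =>
    rw [ae_walkLaw x (hm (n + 1))]
    exact fun s => ih _

lemma ae_isTransientPath (hd : 3 ≤ d) (x : Lattice d) :
    ∀ᵐ X ∂walkLaw x, IsTransientPath x X := by
  filter_upwards [ae_walkLaw_zero x, ae_all_iff.2 fun n => ae_walkLaw_nearest_neighbour n x,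
    ae_all_iff.2 fun K => ae_finite_visits hd K x] with X h1 h2 h3 using ⟨h1, h2, h3⟩

/-- The joint law of the forward part, the backward part and the holding times. -/
def tripleLaw (K : Finset (Lattice d)) (x : Lattice d) :
    Measure ((ℕ → Lattice d) × (ℕ → Lattice d) × (ℤ → ℝ)) :=
  (walkLaw x).prod ((cond (walkLaw x) (neverReturns K)).prod holdingLaw)

lemma pathMeasure_eq (K : Finset (Lattice d)) :
    pathMeasure K = ∑ x ∈ K, equilibrium K x • (tripleLaw K x).map glue := rfl

lemma equilibrium_ne_top (K : Finset (Lattice d)) (x : Lattice d) : equilibrium K x ≠ ∞ := by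
  unfold equilibrium
  split_ifs <;> simp

lemma isProbabilityMeasure_cond_of_equilibrium_ne_zero {K : Finset (Lattice d)} {x : Lattice d}
    (h : equilibrium K x ≠ 0) :
    IsProbabilityMeasure (cond (walkLaw x) (neverReturns K)) := by
  refine cond_isProbabilityMeasure fun h0 => h ?_
  unfold equilibrium
  rw [h0, ite_self]

/-- Forgetting the backward part loses no mass because its law is a probability. This needs positive
equilibrium mass: conditioning on a null event gives the zero measure. -/
lemma measurePreserving_tripleLaw {K : Finset (Lattice d)} {x : Lattice d}
    (h : equilibrium K x ≠ 0) :
    MeasurePreserving (fun p => (p.1, p.2.2)) (tripleLaw K x) (markedLaw x) := by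
  have := isProbabilityMeasure_cond_of_equilibrium_ne_zero h
  exact (MeasurePreserving.id (walkLaw x)).prod measurePreserving_snd

lemma ae_tripleLaw {K : Finset (Lattice d)} {x : Lattice d} (h : equilibrium K x ≠ 0)
    {p q : (ℕ → Lattice d) → Prop} {r : (ℤ → ℝ) → Prop} (hp : ∀ᵐ X ∂walkLaw x, p X)
    (hq : ∀ᵐ Y ∂cond (walkLaw x) (neverReturns K), q Y) (hr : ∀ᵐ σ ∂holdingLaw, r σ) :
    ∀ᵐ t ∂tripleLaw K x, p t.1 ∧ q t.2.1 ∧ r t.2.2 := by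
  have := isProbabilityMeasure_cond_of_equilibrium_ne_zero h
  have h1 : ∀ᵐ t ∂tripleLaw K x, p t.1 := Measure.quasiMeasurePreserving_fst.ae hp
  have h2 : ∀ᵐ t ∂tripleLaw K x, q t.2.1 :=
    Measure.quasiMeasurePreserving_snd.ae (Measure.quasiMeasurePreserving_fst.ae hq)
  have h3 : ∀ᵐ t ∂tripleLaw K x, r t.2.2 :=
    Measure.quasiMeasurePreserving_snd.ae (Measure.quasiMeasurePreserving_snd.ae hr)
  filter_upwards [h1, h2, h3] with t a b c using ⟨a, b, c⟩

lemma ae_pathMeasure {K : Finset (Lattice d)} {p : MarkedPath d → Prop}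
    (hp : MeasurableSet {w | p w})
    (h : ∀ x ∈ K, equilibrium K x ≠ 0 → ∀ᵐ t ∂tripleLaw K x, p (glue t)) :
    ∀ᵐ w ∂pathMeasure K, p w := by
  rw [ae_iff, pathMeasure_eq, Measure.finsetSum_apply]
  refine Finset.sum_eq_zero fun x hx => ?_
  rw [Measure.smul_apply, smul_eq_mul]
  by_cases h0 : equilibrium K x = 0
  · rw [h0, zero_mul]
  · rw [Measure.map_apply measurable_glue (s := {w | ¬p w}) hp.compl]
    exact mul_eq_zero_of_right _ (h x hx h0)

lemma ae_mem_trajectories (hd : 3 ≤ d) (K : Finset (Lattice d)) :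
    ∀ᵐ w ∂pathMeasure K, w ∈ trajectories d := by
  refine ae_pathMeasure (measurableSet_trajectories d) fun x _ h0 => ?_
  have hr : ∀ᵐ σ ∂holdingLaw, (∀ n, 0 < σ n) ∧ ∑' n : ℕ, ENNReal.ofReal (σ n) = ∞ ∧
      ∑' n : ℕ, ENNReal.ofReal (σ (-n)) = ∞ := by
    filter_upwards [ae_holdingLaw_pos, ae_tsum_holdingLaw (f := fun n : ℕ => (n : ℤ))
      Nat.cast_injective, ae_tsum_holdingLaw (f := fun n : ℕ => -(n : ℤ))
      (neg_injective.comp Nat.cast_injective)] with σ a b c using ⟨a, b, c⟩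
  filter_upwards [ae_tripleLaw h0 (ae_isTransientPath hd x)
    (cond_absolutelyContinuous.ae_le (ae_isTransientPath hd x)) hr] with t ht
  exact glue_mem_trajectories ht.1 ht.2.1 ht.2.2.1 ht.2.2.2.1 ht.2.2.2.2

instance (K : Finset (Lattice d)) : IsFiniteMeasure (pathMeasure K) := by
  rw [pathMeasure_eq]
  refine ⟨?_⟩
  rw [Measure.finsetSum_apply]
  refine ENNReal.sum_lt_top.2 fun x _ => ?_
  rw [Measure.smul_apply, smul_eq_mul, Measure.map_apply measurable_glue .univ]
  by_cases h0 : equilibrium K x = 0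
  · rw [h0, zero_mul]
    exact ENNReal.zero_lt_top
  · have := isProbabilityMeasure_cond_of_equilibrium_ne_zero h0
    rw [Set.preimage_univ, tripleLaw, measure_univ, mul_one]
    exact (equilibrium_ne_top K x).lt_top

/-- Almost every glued path is a genuine trajectory, by transience and the divergence of the holding
times, so restricting to the subtype loses nothing. -/
lemma map_val_trajectoryMeasure (hd : 3 ≤ d) (K : Finset (Lattice d)) :
    (trajectoryMeasure K).map Subtype.val = pathMeasure K := by
  rw [trajectoryMeasure, (MeasurableEmbedding.subtype_coe (measurableSet_trajectories d)).map_comap,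
    Subtype.range_coe]
  exact Measure.restrict_eq_self_of_ae_mem (ae_mem_trajectories hd K)

variable {K : Finset (Lattice d)} {V : Lattice d → ℝ}

/-- For each starting point carrying mass, the integrand depends only on the forward walk and the
holding times, and its mean is `feynmanKac V x - 1`. -/
lemma IsAdmissible.integrable_and_integral_pathMeasure (hd : 3 ≤ d) (hV : IsAdmissible K V) :
    Integrable (fun w => Real.exp (-∑ x ∈ K, V x * (pathTimeSpent x w).toReal) - 1)
        (pathMeasure K) ∧
      ∫ w, (Real.exp (-∑ x ∈ K, V x * (pathTimeSpent x w).toReal) - 1) ∂pathMeasure K =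
        ∑ x ∈ K, (equilibrium K x).toReal * (feynmanKac V x - 1) := by
  set h : MarkedPath d → ℝ :=
    fun w => Real.exp (-∑ x ∈ K, V x * (pathTimeSpent x w).toReal) - 1 with hh
  have hm : Measurable h := by
    refine (Measurable.exp (Measurable.neg (Finset.measurable_sum _ fun x _ => ?_))).sub_const 1
    exact (measurable_pathTimeSpent x).ennreal_toReal.const_mul _
  have hae : ∀ x, equilibrium K x ≠ 0 → (fun t => h (glue t)) =ᵐ[tripleLaw K x]
      fun t => Real.exp (-pathIntegral V (t.1, t.2.2)) - 1 := by
    intro x h0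
    filter_upwards [ae_tripleLaw h0 (ae_finite_visits hd K x)
      (ae_cond_mem (measurableSet_neverReturns K)) ae_holdingLaw_pos] with t ht
    simp only [hh]
    rw [sum_mul_pathTimeSpent_glue hV.eq_zero ht.1 ht.2.1 ht.2.2]
  have hi : ∀ x, Integrable (fun p => Real.exp (-pathIntegral V p) - 1) (markedLaw x) := fun x =>
    (hV.integrable_exp_neg hd x).sub (integrable_const 1)
  have hint : ∀ x, Integrable h (equilibrium K x • (tripleLaw K x).map glue) := by
    intro x
    by_cases h0 : equilibrium K x = 0
    · rw [h0, zero_smul]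
      exact integrable_zero_measure
    · refine Integrable.smul_measure ?_ (equilibrium_ne_top K x)
      rw [integrable_map_measure hm.aestronglyMeasurable measurable_glue.aemeasurable]
      exact ((measurePreserving_tripleLaw h0).integrable_comp_of_integrable (hi x)).congr
        (hae x h0).symm
  rw [pathMeasure_eq]
  refine ⟨integrable_finsetSum_measure.2 fun x _ => hint x, ?_⟩
  rw [integral_finsetSum_measure fun x _ => hint x]
  refine Finset.sum_congr rfl fun x _ => ?_
  rw [integral_smul_measure, smul_eq_mul]
  by_cases h0 : equilibrium K x = 0
  · simp [h0]
  · congr 1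
    have hmp := measurePreserving_tripleLaw h0
    rw [integral_map measurable_glue.aemeasurable hm.aestronglyMeasurable,
      integral_congr_ae (hae x h0), feynmanKac]
    have e := integral_map (μ := tripleLaw K x) hmp.measurable.aemeasurable
      (f := fun p => Real.exp (-pathIntegral V p) - 1)
      (by rw [hmp.map_eq]; exact (hi x).aestronglyMeasurable)
    rw [hmp.map_eq] at e
    rw [← e, integral_sub (hV.integrable_exp_neg hd x) (integrable_const 1)]
    simp

/-- The integrand vanishes off `entering K`, where `ν` is not described by `K`; on that set `ν` is
an image of `trajectoryMeasure K`. -/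
lemma IsAdmissible.integrable_and_integral_interlacementMeasure (hd : 3 ≤ d)
    (hV : IsAdmissible K V) {ν : Measure (TrajectoryClass d)} (hν : IsInterlacementMeasure ν) :
    Integrable (fun w => Real.exp (-classIntegral K V w) - 1) ν ∧
      ∫ w, (Real.exp (-classIntegral K V w) - 1) ∂ν =
        ∑ x ∈ K, (equilibrium K x).toReal * (feynmanKac V x - 1) := by
  have h0 : ∀ w, w ∉ entering K → Real.exp (-classIntegral K V w) - 1 = 0 := fun w hw => by
    simp [classIntegral_eq_zero V hw]
  have hm : Measurable fun w => Real.exp (-classIntegral K V w) - 1 :=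
    (measurable_classIntegral K V).neg.exp.sub_const 1
  obtain ⟨h1, h2⟩ := hV.integrable_and_integral_pathMeasure hd
  have hemb := MeasurableEmbedding.subtype_coe (measurableSet_trajectories d)
  rw [← map_val_trajectoryMeasure hd] at h1 h2
  rw [hemb.integrable_map_iff] at h1
  rw [hemb.integral_map] at h2
  rw [← h2, ← integrableOn_iff_integrable_of_support_subset (s := entering K)
    (fun w hw => by_contra fun hc => hw (h0 w hc)),
    ← setIntegral_eq_integral_of_forall_compl_eq_zero
    h0, IntegrableOn, hν.restrict_entering, integrable_map_measure hm.aestronglyMeasurable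
    measurable_proj.aemeasurable, integral_map measurable_proj.aemeasurable
    hm.aestronglyMeasurable]
  exact ⟨h1, rfl⟩

lemma IsInterlacementMeasure.entering_lt_top (hd : 3 ≤ d) {ν : Measure (TrajectoryClass d)}
    (hν : IsInterlacementMeasure ν) (K : Finset (Lattice d)) : ν (entering K) < ∞ := by
  rw [← Measure.restrict_apply_univ, hν.restrict_entering, Measure.map_apply measurable_proj .univ,
    Set.preimage_univ, ← Set.preimage_univ (f := Subtype.val),
    ← Measure.map_apply measurable_subtype_coe .univ, map_val_trajectoryMeasure hd]
  exact measure_lt_top _ _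

end

section

/-! ### Occupation times of the interlacement process -/

lemma measurableEmbedding_coe_nnreal : MeasurableEmbedding ((↑) : ℝ≥0 → ℝ) :=
  MeasurableEmbedding.subtype_coe measurableSet_Ici

lemma halfLineVolume_Iic (u : ℝ≥0) : halfLineVolume (Set.Iic u) = u := by
  rw [halfLineVolume, measurableEmbedding_coe_nnreal.comap_apply]
  have : ((↑) : ℝ≥0 → ℝ) '' Set.Iic u = Set.Icc 0 (u : ℝ) := by
    ext t
    simp only [Set.mem_image, Set.mem_Iic, Set.mem_Icc]
    exact ⟨fun ⟨s, hs, h⟩ => h ▸ ⟨s.2, hs⟩, fun h => ⟨⟨t, h.1⟩, h.2, rfl⟩⟩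
  rw [this, Real.volume_Icc, sub_zero, ENNReal.ofReal_coe_nnreal]

instance : SigmaFinite halfLineVolume :=
  ⟨⟨⟨fun n => Set.Iic (n : ℝ≥0), fun _ => trivial,
    fun n => by rw [halfLineVolume_Iic]; exact ENNReal.coe_lt_top,
    Set.eq_univ_of_forall fun t => Set.mem_iUnion.2 (exists_nat_ge t)⟩⟩⟩

variable {d : ℕ}

/-- The time spent at `x` by a labelled trajectory, if its label is at most `u`. -/
def labelledTime (x : Lattice d) (u : ℝ≥0) (p : TrajectoryClass d × ℝ≥0) : ℝ≥0∞ :=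
  if p.2 ≤ u then timeSpent x p.1 else 0

lemma measurable_labelledTime (x : Lattice d) (u : ℝ≥0) : Measurable (labelledTime x u) :=
  Measurable.ite (measurable_snd measurableSet_Iic)
    ((measurable_timeSpent x).comp measurable_fst) measurable_const

lemma labelledTime_lt_top (x : Lattice d) (u : ℝ≥0) (p : TrajectoryClass d × ℝ≥0) :
    labelledTime x u p < ∞ := by
  unfold labelledTime
  split_ifs
  exacts [timeSpent_lt_top x p.1, ENNReal.zero_lt_top]

lemma lintegral_labelledTime_ne_top (x : Lattice d) (u : ℝ≥0)
    {η : Measure (TrajectoryClass d × ℝ≥0)} (hη : η ∈ configurations d) :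
    ∫⁻ p, labelledTime x u p ∂η ≠ ∞ := by
  obtain ⟨⟨p, rfl⟩, h⟩ := hη
  have hA : MeasurableSet ((entering {x} : Set (TrajectoryClass d)) ×ˢ Set.Iic u) :=
    (measurableSet_entering _).prod measurableSet_Iic
  have h1 := h {x} u
  rw [Measure.sum_apply _ hA] at h1
  -- Each point in the set contributes mass one, so finite mass means finitely many contributing
  -- indices; every single contribution is finite.
  have hfin := ENNReal.finite_const_le_of_tsum_ne_top h1.ne one_ne_zero
  rw [lintegral_sum_measure, tsum_eq_sum (s := hfin.toFinset)]
  · refine (ENNReal.sum_lt_top.2 fun i _ => ?_).ne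
    rw [lintegral_dirac' _ (measurable_labelledTime x u)]
    exact labelledTime_lt_top x u _
  · intro i hi
    rw [lintegral_dirac' _ (measurable_labelledTime x u)]
    by_contra hc
    refine hi (hfin.mem_toFinset.2 ?_)
    have : p i ∈ (entering {x} : Set (TrajectoryClass d)) ×ˢ Set.Iic u := by
      refine ⟨by_contra fun hn => hc ?_, by_contra fun hn => hc (if_neg hn)⟩
      simp [labelledTime, timeSpent_eq_zero (Finset.mem_singleton_self x) hn]
    simp [Measure.dirac_apply' _ hA, this]

/-- The integral of `V` along a labelled trajectory, if its label is at most `u`. -/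
def labelledIntegral (K : Finset (Lattice d)) (V : Lattice d → ℝ) (u : ℝ≥0)
    (p : TrajectoryClass d × ℝ≥0) : ℝ :=
  ∑ x ∈ K, V x * (labelledTime x u p).toReal

lemma labelledIntegral_eq (K : Finset (Lattice d)) (V : Lattice d → ℝ) (u : ℝ≥0)
    (p : TrajectoryClass d × ℝ≥0) :
    labelledIntegral K V u p = if p.2 ≤ u then classIntegral K V p.1 else 0 := by
  unfold labelledIntegral labelledTime classIntegral
  split_ifs <;> simp

lemma measurable_labelledIntegral (K : Finset (Lattice d)) (V : Lattice d → ℝ) (u : ℝ≥0) :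
    Measurable (labelledIntegral K V u) :=
  Finset.measurable_sum _ fun x _ => (measurable_labelledTime x u).ennreal_toReal.const_mul _

lemma integrable_labelledIntegral (K : Finset (Lattice d)) (V : Lattice d → ℝ) (u : ℝ≥0)
    {η : Measure (TrajectoryClass d × ℝ≥0)} (hη : η ∈ configurations d) :
    Integrable (labelledIntegral K V u) η :=
  integrable_finsetSum _ fun x _ => (integrable_toReal_of_lintegral_ne_top
    (measurable_labelledTime x u).aemeasurable (lintegral_labelledTime_ne_top x u hη)).const_mul _

lemma integral_labelledIntegral (K : Finset (Lattice d)) (V : Lattice d → ℝ) (u : ℝ≥0)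
    {η : Measure (TrajectoryClass d × ℝ≥0)} (hη : η ∈ configurations d) :
    ∫ p, labelledIntegral K V u p ∂η = ∑ x ∈ K, V x * occupationTime x u η := by
  unfold labelledIntegral
  rw [integral_finsetSum _ fun x _ => (integrable_toReal_of_lintegral_ne_top
    (measurable_labelledTime x u).aemeasurable (lintegral_labelledTime_ne_top x u hη)).const_mul _]
  refine Finset.sum_congr rfl fun x _ => ?_
  rw [integral_const_mul, integral_toReal (measurable_labelledTime x u).aemeasurable
    (ae_of_all _ fun p => labelledTime_lt_top x u p)]
  rfl

/-- Because `exp 0 - 1 = 0`, the condition on the label becomes a factor, and the integral against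
the product intensity splits. -/
lemma exp_neg_labelledIntegral (K : Finset (Lattice d)) (V : Lattice d → ℝ) (u : ℝ≥0)
    (p : TrajectoryClass d × ℝ≥0) :
    Real.exp (-labelledIntegral K V u p) - 1 =
      (Real.exp (-classIntegral K V p.1) - 1) * (Set.Iic u).indicator 1 p.2 := by
  rw [labelledIntegral_eq]
  by_cases h : p.2 ≤ u <;> simp [h]

variable [NeZero d] {K : Finset (Lattice d)} {V : Lattice d → ℝ}

lemma IsAdmissible.integrable_and_integral_prod (hd : 3 ≤ d) (hV : IsAdmissible K V)
    {ν : Measure (TrajectoryClass d)} (hν : IsInterlacementMeasure ν) (u : ℝ≥0) :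
    Integrable (fun p => Real.exp (-labelledIntegral K V u p) - 1) (ν.prod halfLineVolume) ∧
      ∫ p, (Real.exp (-labelledIntegral K V u p) - 1) ∂(ν.prod halfLineVolume) =
        u * ∑ x ∈ K, (equilibrium K x).toReal * (feynmanKac V x - 1) := by
  have := hν.sigmaFinite
  obtain ⟨h1, h2⟩ := hV.integrable_and_integral_interlacementMeasure hd hν
  have hu : Integrable ((Set.Iic u).indicator (1 : ℝ≥0 → ℝ)) halfLineVolume :=
    (integrable_indicator_iff measurableSet_Iic).2
      (integrableOn_const (by rw [halfLineVolume_Iic]; exact ENNReal.coe_ne_top))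
  simp_rw [exp_neg_labelledIntegral]
  refine ⟨h1.mul_prod hu, ?_⟩
  rw [integral_prod_mul (fun w => Real.exp (-classIntegral K V w) - 1), h2,
    integral_indicator_one measurableSet_Iic, Measure.real, halfLineVolume_Iic, mul_comm]
  rfl

/-- The Laplace functional of the occupation times in terms of the Feynman–Kac functional. -/
theorem IsAdmissible.integral_exp_neg_occupationTime (hd : 3 ≤ d) (hV : IsAdmissible K V)
    {Ω : Type*} [MeasurableSpace Ω] {P : Measure Ω} [IsProbabilityMeasure P]
    {N : Ω → Measure (TrajectoryClass d × ℝ≥0)} (hN : IsInterlacementProcess P N) (u : ℝ≥0) :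
    Integrable (fun ω => Real.exp (-∑ x ∈ K, V x * occupationTime x u (N ω))) P ∧
      ∫ ω, Real.exp (-∑ x ∈ K, V x * occupationTime x u (N ω)) ∂P =
        Real.exp (u * ∑ x ∈ K, (equilibrium K x).toReal * (feynmanKac V x - 1)) := by
  obtain ⟨ν, hν, hP⟩ := hN.poisson
  have := hν.sigmaFinite
  simp_rw [← fun ω => integral_labelledIntegral K V u (hN.mem_configurations ω)]
  rw [← (hV.integrable_and_integral_prod hd hν u).2]
  refine hP.integral_exp_neg (measurable_labelledIntegral K V u)
    ((measurableSet_entering K).prod (measurableSet_Iic (a := u))) ?_ ?_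
    (ae_of_all _ fun ω => integrable_labelledIntegral K V u (hN.mem_configurations ω)) ?_
  · rw [Measure.prod_prod, halfLineVolume_Iic]
    exact ENNReal.mul_lt_top (hν.entering_lt_top hd K) ENNReal.coe_lt_top
  · intro p hp
    rw [labelledIntegral_eq]
    split_ifs with h
    · exact classIntegral_eq_zero V fun hw => hp ⟨hw, h⟩
    · rfl
  · refine (hV.neg_part.integrable_and_integral_prod hd hν u).1.mono'
      (((measurable_labelledIntegral K V u).neg.max measurable_const).exp.sub_const
        1).aestronglyMeasurable (ae_of_all _ fun p => ?_)
    have h1 : 1 ≤ Real.exp (max (-labelledIntegral K V u p) 0) :=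
      Real.one_le_exp (le_max_right _ _)
    rw [Real.norm_of_nonneg (by linarith)]
    refine sub_le_sub_right (Real.exp_le_exp.2 (max_le ?_ ?_)) 1
    · unfold labelledIntegral
      rw [← Finset.sum_neg_distrib, ← Finset.sum_neg_distrib]
      refine Finset.sum_le_sum fun x _ => ?_
      rw [neg_mul, neg_neg, ← neg_mul]
      exact mul_le_mul_of_nonneg_right (le_max_left _ _) ENNReal.toReal_nonneg
    · unfold labelledIntegral
      rw [← Finset.sum_neg_distrib]
      refine Finset.sum_nonneg fun x _ => ?_
      rw [neg_mul, neg_neg]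
      exact mul_nonneg (le_max_right _ _) ENNReal.toReal_nonneg

/-! ### Identification of the exponent -/

/-- Insert `φ - 1 = -G V φ` and move `G` onto the equilibrium measure by symmetry; then `G e_K = 1`
on `K` removes it. -/
lemma IsAdmissible.sum_equilibrium_mul (hd : 3 ≤ d) (hV : IsAdmissible K V) :
    ∑ x ∈ K, (equilibrium K x).toReal * (feynmanKac V x - 1) =
      -∑ y ∈ K, V y * feynmanKac V y := by
  have h1 : ∀ x, feynmanKac V x - 1 = -∑ y ∈ K, green x y * (V y * feynmanKac V y) := fun x => by
    linarith [hV.feynmanKac_add hd x]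
  simp_rw [h1, mul_neg, Finset.sum_neg_distrib, Finset.mul_sum]
  rw [Finset.sum_comm]
  congr 1
  refine Finset.sum_congr rfl fun y hy => ?_
  calc ∑ x ∈ K, (equilibrium K x).toReal * (green x y * (V y * feynmanKac V y))
      = (∑ x ∈ K, green y x * (equilibrium K x).toReal) * (V y * feynmanKac V y) := by
        rw [Finset.sum_mul]
        refine Finset.sum_congr rfl fun x _ => ?_
        rw [green_symm x y]
        ring
    _ = V y * feynmanKac V y := by rw [sum_green_mul_equilibrium hd hy, one_mul]

lemma IsAdmissible.cofactorSum_ratio (hd : 3 ≤ d) (hV : IsAdmissible K V)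
    (h0 : 0 < ∑ I ∈ K.powerset, greenDet I * ∏ x ∈ I, V x) :
    (∑ I ∈ K.powerset, cofactorSum I * ∏ x ∈ I, V x) /
        ∑ I ∈ K.powerset, greenDet I * ∏ x ∈ I, V x =
      ∑ y ∈ K, V y * feynmanKac V y :=
  sum_powerset_ratio green K V (feynmanKac V) (fun I _ => (greenDet_pos hd I).ne') h0.ne'
    fun x _ => hV.feynmanKac_add hd x

/-! ### Positivity of the denominator and choice of the constant -/

lemma sum_powerset_eq_one_add (K : Finset (Lattice d)) (V : Lattice d → ℝ) :
    ∑ I ∈ K.powerset, greenDet I * ∏ x ∈ I, V x =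
      1 + ∑ I ∈ K.powerset.erase ∅, greenDet I * ∏ x ∈ I, V x := by
  rw [← Finset.add_sum_erase _ _ (Finset.empty_mem_powerset K), Finset.prod_empty, mul_one,
    greenDet, Matrix.det_isEmpty]

lemma sum_powerset_pos_of_nonneg (hd : 3 ≤ d) (K : Finset (Lattice d)) (h : ∀ x, 0 ≤ V x) :
    0 < ∑ I ∈ K.powerset, greenDet I * ∏ x ∈ I, V x := by
  rw [sum_powerset_eq_one_add]
  have : 0 ≤ ∑ I ∈ K.powerset.erase ∅, greenDet I * ∏ x ∈ I, V x :=
    Finset.sum_nonneg fun I _ => mul_nonneg (greenDet_pos hd I).le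
      (Finset.prod_nonneg fun x _ => h x)
  linarith

/-- The empty set contributes `1`. In any other term one factor is at most `c` and the others at
most `1`, so these terms total at most `c` times a sum of determinants; the extra `1 +` in `hc`
makes that less than `1`. -/
lemma sum_powerset_pos_of_abs_le (hd : 3 ≤ d) (K : Finset (Lattice d)) {c : ℝ} (hc1 : c ≤ 1)
    (hc : c * (1 + ∑ I ∈ K.powerset, greenDet I) ≤ 1) (h : ∀ x, |V x| ≤ c) :
    0 < ∑ I ∈ K.powerset, greenDet I * ∏ x ∈ I, V x := by
  rw [sum_powerset_eq_one_add]
  have hc0 : 0 ≤ c := (abs_nonneg _).trans (h 0)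
  have h1 : ∀ I ∈ K.powerset.erase ∅, |greenDet I * ∏ x ∈ I, V x| ≤ c * greenDet I := by
    intro I hI
    rw [abs_mul, abs_of_pos (greenDet_pos hd I), mul_comm c, Finset.abs_prod]
    refine mul_le_mul_of_nonneg_left ?_ (greenDet_pos hd I).le
    obtain ⟨z, hz⟩ := Finset.nonempty_iff_ne_empty.2 (Finset.ne_of_mem_erase hI)
    rw [← Finset.mul_prod_erase _ _ hz]
    calc |V z| * ∏ x ∈ I.erase z, |V x| ≤ c * 1 :=
          mul_le_mul (h z) (Finset.prod_le_one (fun _ _ => abs_nonneg _)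
            fun x _ => (h x).trans hc1) (Finset.prod_nonneg fun _ _ => abs_nonneg _) hc0
      _ = c := mul_one c
  have h2 : |∑ I ∈ K.powerset.erase ∅, greenDet I * ∏ x ∈ I, V x| ≤
      c * ∑ I ∈ K.powerset.erase ∅, greenDet I := by
    rw [Finset.mul_sum]
    exact (Finset.abs_sum_le_sum_abs _ _).trans (Finset.sum_le_sum h1)
  have h3 : ∑ I ∈ K.powerset, greenDet I =
      1 + ∑ I ∈ K.powerset.erase ∅, greenDet I := by
    simpa using sum_powerset_eq_one_add K fun _ => 1
  have h4 := (abs_le.1 h2).1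
  rw [h3] at hc
  have h5 : 0 ≤ ∑ I ∈ K.powerset.erase ∅, greenDet I :=
    Finset.sum_nonneg fun I _ => (greenDet_pos hd I).le
  rcases hc0.eq_or_lt with rfl | hc0
  · linarith
  · nlinarith

lemma exists_admissible_const (hd : 3 ≤ d) (K : Finset (Lattice d)) : ∃ c : ℝ, 0 < c ∧ c ≤ 1 ∧
    c * (1 + ∑ I ∈ K.powerset, greenDet I) ≤ 1 ∧ ∀ x, c * (1 + greenSum K x) ≤ 1 := by
  obtain ⟨C, hC⟩ := exists_green_le (d := d) hd
  have hC0 : 0 ≤ C := (green_nonneg 0 0).trans (hC 0 0)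
  set A := ∑ I ∈ K.powerset, greenDet I
  have hA : 0 ≤ A := Finset.sum_nonneg fun I _ => (greenDet_pos hd I).le
  set B := K.card * C
  have hB : 0 ≤ B := by positivity
  have hK : ∀ x, greenSum K x ≤ B := fun x => by
    refine (Finset.sum_le_card_nsmul K _ C fun y _ => hC x y).trans_eq ?_
    rw [nsmul_eq_mul]
  have hp : 0 < 1 + A + B := by positivity
  -- `A` controls the sum of determinants and `B` bounds `greenSum K` uniformly, so one constant
  -- serves positivity of the denominator and admissibility.
  refine ⟨(1 + A + B)⁻¹, inv_pos.2 hp, inv_le_one_of_one_le₀ (by linarith), ?_, fun x => ?_⟩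
  · rw [inv_mul_le_one₀ hp]
    linarith
  · rw [inv_mul_le_one₀ hp]
    linarith [hK x]

end

end Interlacement

end

theorem theorem2p3 (d : ℕ) [NeZero d] (hd : 3 ≤ d) :
    (∀ I : Finset (Interlacement.Lattice d),
      0 < Interlacement.greenDet I ∧
        Interlacement.cofactorSum I / Interlacement.greenDet I = Interlacement.capacity I) ∧
    ∀ K : Finset (Interlacement.Lattice d), ∃ c : ℝ, 0 < c ∧
      ∀ V : Interlacement.Lattice d → ℝ, (∀ x, x ∉ K → V x = 0) →
        ((∀ x, |V x| ≤ c) ∨ (∀ x, 0 ≤ V x)) →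
        0 < ∑ I ∈ K.powerset, Interlacement.greenDet I * ∏ x ∈ I, V x ∧
        ∀ (Ω : Type*) [MeasurableSpace Ω] (P : Measure Ω) [IsProbabilityMeasure P]
          (N : Ω → Measure (Interlacement.TrajectoryClass d × ℝ≥0)),
          Interlacement.IsInterlacementProcess P N → ∀ u : ℝ≥0,
            Integrable
              (fun ω => Real.exp (-∑ x ∈ K, V x * Interlacement.occupationTime x u (N ω))) P ∧
            ∫ ω, Real.exp (-∑ x ∈ K, V x * Interlacement.occupationTime x u (N ω)) ∂P =
              Real.exp (-(u : ℝ) *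
                ((∑ I ∈ K.powerset, Interlacement.cofactorSum I * ∏ x ∈ I, V x) /
                  ∑ I ∈ K.powerset, Interlacement.greenDet I * ∏ x ∈ I, V x)) := by
  refine ⟨fun I => ⟨Interlacement.greenDet_pos hd I,
    Interlacement.cofactorSum_div_greenDet hd I⟩, fun K => ?_⟩
  obtain ⟨c, hc0, hc1, hcA, hcB⟩ := Interlacement.exists_admissible_const hd K
  refine ⟨c, hc0, fun V hVK hV => ?_⟩
  have hadm : Interlacement.IsAdmissible K V := by
    refine ⟨hVK, fun x => ?_⟩
    rcases hV with hV | hV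
    · refine le_trans (mul_le_mul_of_nonneg_right ?_ ?_) (hcB x)
      · exact max_le ((neg_le_abs _).trans (hV x)) hc0.le
      · linarith [Interlacement.greenSum_nonneg K x]
    · simp [hV x]
  have hpos : 0 < ∑ I ∈ K.powerset, Interlacement.greenDet I * ∏ x ∈ I, V x := by
    rcases hV with hV | hV
    · exact Interlacement.sum_powerset_pos_of_abs_le hd K hc1 hcA hV
    · exact Interlacement.sum_powerset_pos_of_nonneg hd K hV
  refine ⟨hpos, fun Ω _ P _ N hN u => ?_⟩
  -- The ratio becomes `∑ V φ` and then, through the equilibrium measure, the exponent delivered by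
  -- the Poisson computation.
  rw [hadm.cofactorSum_ratio hd hpos, neg_mul, ← mul_neg, ← hadm.sum_equilibrium_mul hd]
  exact hadm.integral_exp_neg_occupationTime hd hN u
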